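/- **Setting.** All norms are $\ell_2$ norms. Let $V=\{1,\dots,m\}$, let $\overline{\mathcal X}\subset\mathbb R^{\bar d}$ be nonempty, closed and convex, let $f_v:\overline{\mathcal X}\to\mathbb R$ ($v\in V$) be convex with subgradient oracles $f'_v(x)\in\partial f_v(x)$, and let $x^*$ minimize $\sum_v f_v$ over $\overline{\mathcal X}$. Put $\mathcal X=\prod_{v}\overline{\mathcal X}$, $F(X)=\sum_v f_v(x_v)$, $F'(X)=(f'_v(x_v))_v$, $X^*=(x^*)_v$, $(\Pi X)_v=\frac1m\sum_{v'}x_{v'}$, and let $\mu,M\ge 0$ satisfy $$\tfrac{\mu}{2}\|X-X'\|^2\le F(X)-F(X')-\langle F'(X'),X-X'\rangle\le M\|X-X'\|\qquad\forall X,X'\in\mathcal X$$ (if each $f_v$ satisfies the analogous bounds with $\mu_f,M_f$, one can take $\mu=\mu_f$, $M=\sqrt m\,M_f$). Let $S\ge 1$ and let $K_s:\mathbb R^{m\bar d}\to\mathbb R^{n_s}$ ($s=1,\dots,S$) be nonzero linear maps such that the stacked map $KX=(K_sX)_s$ satisfies $KX=0$ iff $x_v=x_{v'}$ for all $v,v'$.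 For a linear map $B$ let $\|B\|$ be its operator norm, $\Pi_B=B^*(BB^*)^\dagger B$ the orthogonal projection onto $(\ker B)^\perp$, and $\sigma^+_{\min}(B)=\min_{\Pi_BX\ne0}\|BX\|/\|\Pi_BX\|$; write $\Pi_s=\Pi_{K_s}$. A *subgradient oracle* $\nabla F$ is a map on $\mathcal X$ with $(\nabla F(X))_v\in\partial f_v(x_v)$. * $\{f_v\}$ is *$\widehat a_1$-similar* if for some subgradient oracle $\|(I-\Pi)\nabla F(X)\|\le\widehat a_1$ for all $X\in\mathcal X$ with all $x_v$ equal. * $\{f_v\}$ is *$\{(a_s,K_s)\}$-similar* if $K_sK_{s'}^*=0$ for $s\ne s'$ and for some subgradient oracle $\|\Pi_s\nabla F(X)\|\le a_s$ for all $s$ and all $X\in\mathcal X$ with $KX=0$. * $X$ is an *$(\epsilon,\delta)$-solution* if $X\in\mathcal X$, $F(X)\le F(X^*)+\epsilon$ and $\|(I-\Pi)X\|\le\delta$. **Algorithm (MT-PDHG with gradient sliding).** Let $r_s\ge1$ be integers with $r_s\mid N+1$ for all $s$, $\rho_s>0$ with $\sum_s\rho_s=1$, $\overline r=\sum_s r_s\rho_s$,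 $X^{init}\in\mathcal X$, and $D(x,x')=\frac12\|x-x'\|^2$. Let the penalties be $R_s(y)=c_s\|y\|$ with $c_s>0$, let $R_s^*$ be their Fenchel conjugates, $D^y_s=c_s^2/2$, $D^X>0$ with $D(X^*,X^{init})\le D^X$, $\eta=\big(\sum_s\|K_s\|\sqrt{D^y_s}\big)\sqrt{8/(3D^X)}$, $\tau_s=2\|K_s\|^2/(\rho_s\eta)$, and let $T\ge1$ be an integer with $T\ge\big\lfloor 4M^2(N+1)/\big(\overline r(\sum_s\|K_s\|\sqrt{D^y_s})^2\big)\big\rfloor$. Set $X^k=\widehat X^k=X^{init}$ for $k<0$ and $y_s^i=0$ for $i<0$. For $k=0,\dots,N$: 1. for every $s$ with $k=r_si$, put $\widetilde X_s^i=\sum_{k'=k-r_s}^{k-1}\big(\widehat X^{k'}-X^{k'-r_s}+X^{k'}\big)$ and $y_s^i=\operatorname{argmin}_{y}\ \langle-\tfrac1{r_s}K_s\widetilde X_s^i,y\rangle+R_s^*(y)+\tau_sD(y,y_s^{i-1})$; 2. with $g^k=\sum_sK_s^*y_s^{\lfloor k/r_s\rfloor}$ and $u^0=X^{k-1}$, for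 $t=1,\dots,T$ let $u^t=\operatorname{argmin}_{u\in\mathcal X}\langle g^k+F'(u^{t-1}),u\rangle+\sum_s\eta\rho_sD(u,X^{k-r_s})+\eta\tfrac t2D(u,u^{t-1})$; put $X^k=u^T$ and $\widehat X^k=\big(\sum_{t=1}^T(t+1)\big)^{-1}\sum_{t=1}^T(t+1)u^t$. **Statement.** Let $\xi,\epsilon>0$, write $\overline X^N=\frac1{N+1}\sum_{k=0}^N\widehat X^k$, and assume $$N\ge\frac{2\sqrt3\,\overline r\,A\sqrt{D^X}}{\epsilon}$$ with $A$ as specified below. In each of the following cases $D_s^y=\sup_{y\in\operatorname{dom}R_s^*}D(y,0)$ (that is, $\sqrt{2D_s^y}=c_s$), and the stated conclusion holds. 1. Let $\{f_v\}$ be $\widehat a_1$-similar and $\rho_s=\|K_s\|/\sum_{s'}\|K_{s'}\|$. (a) If $c_s=\frac{\xi+\widehat a_1}{\sigma^+_{\min}(K)}$ and $A=\frac{\sum_s\|K_s\|}{\sigma^+_{\min}(K)}(\xi+\widehat a_1)$, then $\overline X^N$ is an $(\epsilon,\epsilon/\xi)$-solution. (b) If $\widehat a_1>0$, $c_s=\frac{(1+\xi)\widehat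 a_1}{\sigma^+_{\min}(K)}$ and $A=\frac{(1+\xi)(\sum_s\|K_s\|)\widehat a_1}{\sigma^+_{\min}(K)}$, then $\Pi\overline X^N$ is an $(\epsilon(1+1/\xi),0)$-solution. 2. Let $\{f_v\}$ be $\{(a_s,K_s)\}$-similar. (a) If $c_s=\frac{\xi+a_s}{\sigma^+_{\min}(K_s)}$, $\rho_s=\frac{\|K_s\|(\xi+a_s)/\sigma^+_{\min}(K_s)}{\sum_{s'}\|K_{s'}\|(\xi+a_{s'})/\sigma^+_{\min}(K_{s'})}$ and $A=\sum_s(\xi+a_s)\frac{\|K_s\|}{\sigma^+_{\min}(K_s)}$, then $\overline X^N$ is an $(\epsilon,\epsilon/\xi)$-solution. (b) If $a_s>0$ for all $s$, $c_s=\frac{(1+\xi)a_s}{\sigma^+_{\min}(K_s)}$, $\rho_s=\frac{\|K_s\|a_s/\sigma^+_{\min}(K_s)}{\sum_{s'}\|K_{s'}\|a_{s'}/\sigma^+_{\min}(K_{s'})}$ and $A=(1+\xi)\sum_sa_s\frac{\|K_s\|}{\sigma^+_{\min}(K_s)}$, then $\Pi\overline X^N$ is an $(\epsilon(1+1/\xi),0)$-solution.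 -/

import Mathlib

open scoped InnerProductSpace BigOperators

noncomputable section

namespace MTPDHG

/-! ### Convex-analytic notions -/

section General

variable {E : Type*} [NormedAddCommGroup E] [InnerProductSpace ℝ E]

/-- `g` is a subgradient at `x` of the function `f : U → ℝ`. -/
def IsSubgradient (U : Set E) (f : E → ℝ) (x g : E) : Prop :=
  ∀ y ∈ U, f x + ⟪g, y - x⟫_ℝ ≤ f y

/-- The distance generating function `w(x) = ‖x‖² / 2`. -/
def halfSq (x : E) : ℝ := (1 / 2) * ‖x‖ ^ 2

/-- The Bregman divergence `D_w(x, z) = w(x) - w(z) - ⟨∇w(z), x - z⟩`. -/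
def bregman [CompleteSpace E] (w : E → ℝ) (x z : E) : ℝ :=
  w x - w z - ⟪gradient w z, x - z⟫_ℝ

/-- The Fenchel conjugate of an extended-real-valued function. -/
def fenchelConj (R : E → EReal) (y : E) : EReal :=
  ⨆ y' : E, (((⟪y, y'⟫_ℝ : ℝ) : EReal) - R y')

/-- The effective domain of an extended-real-valued function. -/
def effDom (g : E → EReal) : Set E := {y | g y < ⊤}

/-- The scaled norm `y ↦ c ‖y‖`, used as a penalty. -/
def scaledNorm (c : ℝ) (y : E) : EReal := ((c * ‖y‖ : ℝ) : EReal)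

end General

section Operators

variable {E H : Type*} [NormedAddCommGroup E] [InnerProductSpace ℝ E] [FiniteDimensional ℝ E]
  [NormedAddCommGroup H] [InnerProductSpace ℝ H] [FiniteDimensional ℝ H]

/-- The orthogonal projection onto the row space `(ker A)ᗮ` of `A`; it is `A* (A A*)† A`,
see `adjoint_comp_comp_eq_rowProj`. -/
def rowProj (A : E →L[ℝ] H) : E →L[ℝ] E :=
  (LinearMap.ker (A : E →ₗ[ℝ] H))ᗮ.starProjection

/-- If `Q` is the Moore-Penrose inverse of `G = A A*` (only the Penrose identity `G Q G = G` is
needed), then `A* Q A` is `rowProj A`. -/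
theorem adjoint_comp_comp_eq_rowProj [CompleteSpace E] [CompleteSpace H]
    (A : E →L[ℝ] H) (Q : H →L[ℝ] H)
    (hQ : ∀ z, A (A.adjoint (Q (A (A.adjoint z)))) = A (A.adjoint z)) (x : E) :
    A.adjoint (Q (A x)) = rowProj A x := by
  have hker : ∀ x ∈ LinearMap.ker (A : E →ₗ[ℝ] H), A x = 0 := fun x hx => by simpa using hx
  have hmem : ∀ z, A.adjoint z ∈ (LinearMap.ker (A : E →ₗ[ℝ] H))ᗮ := by
    intro z
    rw [Submodule.mem_orthogonal]
    intro u hu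
    rw [ContinuousLinearMap.adjoint_inner_right, hker u hu, inner_zero_left]
  -- the range of `A*` is dense enough: `A x = A (A* z)` for some `z`
  have hrange : (LinearMap.range (A.adjoint : H →ₗ[ℝ] E))ᗮ ≤ LinearMap.ker (A : E →ₗ[ℝ] H) := by
    intro u hu
    rw [Submodule.mem_orthogonal] at hu
    have h := hu (A.adjoint (A u)) ⟨A u, rfl⟩
    rw [ContinuousLinearMap.adjoint_inner_left] at h
    simpa using h
  have hex : ∃ z, A x = A (A.adjoint z) := by
    set W := LinearMap.range (A.adjoint : H →ₗ[ℝ] E) with hW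
    obtain ⟨z, hz⟩ : W.starProjection x ∈ W := Submodule.starProjection_apply_mem W x
    refine ⟨z, ?_⟩
    have h1 : x - W.starProjection x ∈ Wᗮ := Submodule.sub_starProjection_mem_orthogonal x
    have h2 := hker _ (hrange h1)
    rw [map_sub, sub_eq_zero] at h2
    rw [h2, ← hz]
    rfl
  obtain ⟨z, hz⟩ := hex
  have hA : A (A.adjoint (Q (A x))) = A x := by rw [hz]; exact hQ z
  symm
  refine Submodule.eq_starProjection_of_mem_orthogonal (hmem _) ?_
  apply Submodule.le_orthogonal_orthogonal
  simp [map_sub, hA]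

/-- The smallest non-zero singular value `σ⁺_min(A) = min_{P X ≠ 0} ‖A X‖ / ‖P X‖`, where `P` is
the orthogonal projection onto the row space of `A`. -/
def sigmaMinPos (A : E →L[ℝ] H) : ℝ :=
  sInf {t | ∃ X : E, rowProj A X ≠ 0 ∧ t = ‖A X‖ / ‖rowProj A X‖}

end Operators

/-! ### The multi-timescale primal-dual algorithm with gradient sliding -/

section Algorithm

variable {E : Type*} [NormedAddCommGroup E] [InnerProductSpace ℝ E]

/-- `(uT, uhat)` is the output of the generalized gradient sliding procedure with subgradient
oracle `φ'`, feasible set `U`, divergence `D`, weights `lam`, `β`, number of steps `T`,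
proximal weights `η i` and centers `c i`, linear term `v` and starting point `x₀`. -/
def IsGradientSliding {ι : Type*} [Fintype ι] (φ' : E → E) (U : Set E) (D : E → E → ℝ)
    (lam β : ℕ → ℝ) (T : ℕ) (η : ι → ℝ) (v : E) (c : ι → E) (x₀ uT uhat : E) : Prop :=
  ∃ u : ℕ → E, u 0 = x₀ ∧
    (∀ t ∈ Finset.Icc 1 T, u t ∈ U ∧
      IsMinOn (fun w => ⟪v + φ' (u (t - 1)), w⟫_ℝ + ∑ i, η i * D w (c i)
        + (∑ i, η i) * β t * D w (u (t - 1))) U (u t)) ∧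
    uT = u T ∧
    uhat = (∑ t ∈ Finset.Icc 1 T, lam t)⁻¹ • ∑ t ∈ Finset.Icc 1 T, lam t • u t

/-- The parameters of the algorithm with `S` dual blocks: extrapolation weights `α s i`,
averaging weights `θ k`, proximal weights `η k s` and `τ s i`, update rates `r s`, and the numbers
of steps `T k` and weights `lam`, `β` of the gradient sliding procedure. -/
structure Params (S : ℕ) where
  α : Fin S → ℤ → ℝ
  θ : ℤ → ℝ
  η : ℤ → Fin S → ℝ
  τ : Fin S → ℤ → ℝ
  r : Fin S → ℕ
  T : ℤ → ℕ
  lam : ℕ → ℝ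
  β : ℕ → ℝ

variable {S : ℕ} {H : Fin S → Type*} [∀ s, NormedAddCommGroup (H s)]
  [∀ s, InnerProductSpace ℝ (H s)]

/-- The multi-timescale extrapolation `X̃_s^i`. -/
def extrapolate (p : Params S) (X Xhat : ℤ → E) (s : Fin S) (i : ℤ) : E :=
  p.α s i • (∑ k ∈ Finset.Ico (p.r s * i - p.r s) (p.r s * i : ℤ),
      p.θ k • (Xhat k - X (k - p.r s)))
    + ∑ k ∈ Finset.Ico (p.r s * i - p.r s) (p.r s * i : ℤ), p.θ (k + p.r s) • X k

/-- `X`, `Xhat`, `y` are the iterates, up to global time `N`, of the multi-timescale primal-dual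
hybrid gradient algorithm with gradient sliding for
`min_{X ∈ U} max_Y F(X) + ∑ s, (⟨K s X, y s⟩ - Rconj s (y s))`. Here `F'` is a subgradient oracle
of `F`, and `y s i` is the `s`-th dual block at its local time `i`, that is, from global time
`r s * i` on. -/
structure IsRun [CompleteSpace E] [∀ s, CompleteSpace (H s)] (p : Params S) (N : ℕ)
    (U : Set E) (F' : E → E) (K : ∀ s, E →L[ℝ] H s) (Rconj : ∀ s, H s → EReal)
    (wX : E → ℝ) (wY : ∀ s, H s → ℝ) (Xinit : E) (yinit : ∀ s, H s)
    (X Xhat : ℤ → E) (y : ∀ s, ℤ → H s) : Prop where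
  init_primal : ∀ k < 0, X k = Xinit ∧ Xhat k = Xinit
  init_dual : ∀ s, ∀ i < 0, y s i = yinit s
  dual_update : ∀ s, ∀ i : ℤ, 0 ≤ i → p.r s * i ≤ N →
    IsMinOn (fun z : H s =>
      ((⟪-((∑ k ∈ Finset.Ico (p.r s * i : ℤ) (p.r s * i + p.r s), p.θ k)⁻¹
            • K s (extrapolate p X Xhat s i)), z⟫_ℝ
          + p.τ s i * bregman (wY s) z (y s (i - 1)) : ℝ) : EReal) + Rconj s z)
      Set.univ (y s i)
  primal_update : ∀ k : ℤ, 0 ≤ k → k ≤ N →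
    IsGradientSliding F' U (bregman wX) p.lam p.β (p.T k) (p.η k)
      (∑ s, (K s).adjoint (y s (k / (p.r s : ℤ)))) (fun s => X (k - p.r s)) (X (k - 1))
      (X k) (Xhat k)

/-- The average update rate `∑ s, r s * ρ s`. -/
def rbar (r : Fin S → ℕ) (ρ : Fin S → ℝ) : ℝ := ∑ s, (r s : ℝ) * ρ s

variable [CompleteSpace E] [∀ s, CompleteSpace (H s)]

/-- The aggregate `∑ s, κ s * √(Dy s)` with `κ s = sup_{‖z‖ ≤ 1} ‖(K s)* z‖`. -/
def dualSize (K : ∀ s, E →L[ℝ] H s) (Dy : Fin S → ℝ) : ℝ :=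
  ∑ s, ‖(K s).adjoint‖ * √(Dy s)

/-- The step size `η = (∑ s, κ s * √(Dy s)) * √(8 / (3 DX))`. -/
def etaBase (K : ∀ s, E →L[ℝ] H s) (Dy : Fin S → ℝ) (DX : ℝ) : ℝ :=
  dualSize K Dy * √(8 / (3 * DX))

/-- The parameters for general convex objectives: `α = θ = 1`, `η_{k,s} = η ρ_s`,
`τ_s = 2 κ_s² / (ρ_s η)`, and `T` sliding steps with `λ_t = t + 1`, `β_t = t / 2`. -/
def convexParams (K : ∀ s, E →L[ℝ] H s) (Dy : Fin S → ℝ) (DX : ℝ) (ρ : Fin S → ℝ)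
    (r : Fin S → ℕ) (T : ℕ) : Params S where
  α := fun _ _ => 1
  θ := fun _ => 1
  η := fun _ s => etaBase K Dy DX * ρ s
  τ := fun s _ => 2 * ‖(K s).adjoint‖ ^ 2 / (ρ s * etaBase K Dy DX)
  r := r
  T := fun _ => T
  lam := fun t => (t : ℝ) + 1
  β := fun t => (t : ℝ) / 2

end Algorithm

/-! ### Distributed optimization -/

/-- The space `ℝ^d̄` of the decision variable. -/
abbrev Point (d : ℕ) := EuclideanSpace ℝ (Fin d)

/-- The lifted space `∏_v ℝ^d̄` over `m` agents, with the `ℓ2` norm. -/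
abbrev Lifted (m d : ℕ) := PiLp 2 (fun _ : Fin m => Point d)

section Distributed

variable {m d S : ℕ} {n : Fin S → ℕ}

/-- The lifted feasible set `∏_v X̄`. -/
def liftSet (m : ℕ) (Xbar : Set (Point d)) : Set (Lifted m d) := {X | ∀ v, X v ∈ Xbar}

/-- The lifted objective `F(X) = ∑ v, f_v(x_v)`. -/
def liftFun (f : Fin m → Point d → ℝ) (X : Lifted m d) : ℝ := ∑ v, f v (X v)

/-- The lifted oracle `F'(X) = (f'_v(x_v))_v`. -/
def liftOracle (f' : Fin m → Point d → Point d) (X : Lifted m d) : Lifted m d :=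
  WithLp.toLp 2 (fun v => f' v (X v))

/-- The consensus vector `(x)_v`. -/
def diag (m : ℕ) (x : Point d) : Lifted m d := WithLp.toLp 2 (fun _ => x)

/-- The consensus projection `Π`. -/
def avg (X : Lifted m d) : Lifted m d := diag m ((1 / (m : ℝ)) • ∑ v, X v)

/-- The distance generating function `w_X(X) = ∑ v, ‖x_v‖² / 2`. -/
def liftHalfSq (X : Lifted m d) : ℝ := ∑ v, halfSq (X v)

/-- The stacked operator `K`, `(K X)_s = K_s X`. -/
def stack (K : ∀ s, Lifted m d →L[ℝ] Point (n s)) :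
    Lifted m d →L[ℝ] PiLp 2 (fun s => Point (n s)) :=
  ((PiLp.continuousLinearEquiv 2 ℝ (fun s => Point (n s))).symm :
    (∀ s, Point (n s)) →L[ℝ] PiLp 2 (fun s => Point (n s))) ∘L ContinuousLinearMap.pi K

/-- `g : 𝒳 → ℝ^d` is a subgradient oracle of the lifted objective: `(g X)_v ∈ ∂f_v(x_v)`. -/
def IsLiftedOracle (Xbar : Set (Point d)) (f : Fin m → Point d → ℝ)
    (g : Lifted m d → Lifted m d) : Prop :=
  ∀ X ∈ liftSet m Xbar, ∀ v, IsSubgradient Xbar (f v) (X v) (g X v)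

/-- The functions `f_v` are `{(a_s, K_s)}`-similar. -/
def BlockSimilar (Xbar : Set (Point d)) (f : Fin m → Point d → ℝ)
    (K : ∀ s, Lifted m d →L[ℝ] Point (n s)) (a : Fin S → ℝ) : Prop :=
  (∀ s s', s ≠ s' → (K s) ∘L (K s').adjoint = 0) ∧
  ∃ g, IsLiftedOracle Xbar f g ∧
    ∀ s, ∀ X ∈ liftSet m Xbar, stack K X = 0 → ‖rowProj (K s) (g X)‖ ≤ a s

/-- The functions `f_v` are `a`-similar: the one-block notion, for the consensus constraint and
the projection `I - Π`. -/
def Similar (Xbar : Set (Point d)) (f : Fin m → Point d → ℝ) (a : ℝ) : Prop :=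
  ∃ g, IsLiftedOracle Xbar f g ∧
    ∀ X ∈ liftSet m Xbar, (∀ v v', X v = X v') → ‖g X - avg (g X)‖ ≤ a

/-- `X` is an `(ε, δ)`-solution; `xs` is a minimizer of `∑ v, f_v` over `X̄`. -/
def IsSolution (Xbar : Set (Point d)) (f : Fin m → Point d → ℝ) (xs : Point d)
    (ε δ : ℝ) (X : Lifted m d) : Prop :=
  X ∈ liftSet m Xbar ∧ liftFun f X ≤ liftFun f (diag m xs) + ε ∧ ‖X - avg X‖ ≤ δ

/-- The ergodic average `(N + 1)⁻¹ ∑_{k=0}^N X̂^k`. -/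
def ergodic (N : ℕ) (Xhat : ℤ → Lifted m d) : Lifted m d :=
  ((N : ℝ) + 1)⁻¹ • ∑ k ∈ Finset.range (N + 1), Xhat (k : ℤ)

/-- `Dy = sup_{z ∈ dom R*} D(z, 0)` for the penalty `R(y) = c ‖y‖` and `w(y) = ‖y‖² / 2`. -/
def IsDualRadius {k : ℕ} (c Dy : ℝ) : Prop :=
  IsLUB ((fun z : Point k => bregman halfSq z 0) '' effDom (fenchelConj (scaledNorm c))) Dy

/-- The algorithm is run on the lifted problem with penalties `R_s = c_s ‖·‖`, `w = ‖·‖² / 2`,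
dual starting point `0`, block weights `ρ`, dual radii `Dy`, primal radius `DX`, and at least
`max (1, ⌊4 M² (N + 1) / (r̄ (∑ s, κ_s √(Dy_s))²)⌋)` sliding steps per primal update;
`Xhat` is its auxiliary primal sequence. -/
def Runs (Xbar : Set (Point d)) (f' : Fin m → Point d → Point d)
    (K : ∀ s, Lifted m d →L[ℝ] Point (n s)) (M : ℝ) (r : Fin S → ℕ) (Xinit : Lifted m d)
    (DX : ℝ) (N : ℕ) (c Dy ρ : Fin S → ℝ) (Xhat : ℤ → Lifted m d) : Prop :=
  ∃ (T : ℕ) (X : ℤ → Lifted m d) (y : ∀ s, ℤ → Point (n s)),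
    1 ≤ T ∧
    ⌊4 * M ^ 2 * ((N : ℝ) + 1) / (rbar r ρ * dualSize K Dy ^ 2)⌋₊ ≤ T ∧
    IsRun (convexParams K Dy DX ρ r T) N (liftSet m Xbar) (liftOracle f') K
      (fun s => fenchelConj (scaledNorm (c s))) liftHalfSq (fun _ => halfSq)
      Xinit (fun _ => 0) X Xhat y

end Distributed

end MTPDHG

end

namespace MTPDHG

/-! ### Quadratic divergences, conjugates of norms, and minimizers of functions of constant
curvature. -/

section General

variable {E : Type*} [NormedAddCommGroup E] [InnerProductSpace ℝ E]

/-! The conjugate of `c‖·‖` is the indicator of the ball of radius `c`, so the method solves a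
saddle-point problem whose dual variables range over balls, and its primal form is `F` plus the
penalty `∑ c_s ‖K_s X‖`. The proof bounds the primal-dual gap at the ergodic average, then shows
that the penalty is exact.

For the gap, each primal update is an inexact proximal step: `IsGradientSliding.exists_bound` gives
the usual three-point inequality up to a restart term and an error of order `M² / (η T)`. Each dual
update is an exact proximal step (`IsRun.dual_step`). A dual block is frozen for `r` steps, and the
extrapolated point is designed so that the bilinear terms telescope over windows of length `r`; what
remains is absorbed by the primal and dual proximal terms through Young's inequality
(`sum_block_inner_le`). Since a block compares `X^k` with `X^{k-r}`, the distances to a comparison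
point leave `r` initial terms, which after weighting by `ρ` produce the factor `rbar`
(`IsRun.sum_gap_le`). With `ρ_s` proportional to `‖K_s‖ c_s` and the chosen `η`, all errors become
multiples of one quantity that the bound on `N` controls. Jensen's inequality and dual vectors
aligned with `K_s` of the average give `Runs.gap_le`.

For exactness, apply the subgradient inequality at the consensus point `avg X`. Only the component
of the subgradient orthogonal to consensus pairs with `X - avg X`, and similarity bounds it
(`Similar.le`, `BlockSimilar.le`). The definition of `sigmaMinPos` turns distance to consensus into
`‖K_s X‖`, so the penalty dominates what `F` can gain by leaving consensus, with a margin `ξ‖X - avg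
X‖` in the unprojected cases. -/

theorem bregman_halfSq [CompleteSpace E] (x z : E) :
    bregman halfSq x z = 1 / 2 * ‖x - z‖ ^ 2 := by
  have h1 : HasFDerivAt (halfSq : E → ℝ) ((1 / 2 : ℝ) • (2 • innerSL ℝ z)) z :=
    (hasStrictFDerivAt_norm_sq z).hasFDerivAt.const_mul (1 / 2 : ℝ)
  have h2 : ⟪gradient halfSq z, x - z⟫_ℝ = ⟪z, x - z⟫_ℝ := by
    rw [h1.hasGradientAt.gradient, InnerProductSpace.toDual_symm_apply]
    simp
  rw [bregman, h2, inner_sub_right, real_inner_self_eq_norm_sq, norm_sub_sq_real,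
    real_inner_comm z x, halfSq, halfSq]
  ring

theorem fenchelConj_scaledNorm_of_le {c : ℝ} {y : E} (hy : ‖y‖ ≤ c) :
    fenchelConj (scaledNorm c) y = 0 := by
  unfold fenchelConj scaledNorm
  apply le_antisymm
  · refine iSup_le fun y' => ?_
    rw [← EReal.coe_sub, ← EReal.coe_zero, EReal.coe_le_coe_iff]
    nlinarith [real_inner_le_norm y y', norm_nonneg y']
  · refine le_iSup_of_le 0 ?_
    simp

theorem fenchelConj_scaledNorm_of_lt {c : ℝ} (hc : 0 ≤ c) {y : E} (hy : c < ‖y‖) :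
    fenchelConj (scaledNorm c) y = ⊤ := by
  rw [EReal.eq_top_iff_forall_lt]
  intro B
  have hpos : 0 < ‖y‖ * (‖y‖ - c) := mul_pos (hc.trans_lt hy) (sub_pos.2 hy)
  -- At `t • y` the expression in the supremum equals `t * (‖y‖ * (‖y‖ - c))`; this `t` makes it
  -- `|B| + 1`, which exceeds `B`.
  set t : ℝ := (|B| + 1) / (‖y‖ * (‖y‖ - c)) with ht
  have ht0 : 0 < t := by positivity
  have hval : ⟪y, t • y⟫_ℝ - c * ‖t • y‖ = |B| + 1 := by
    rw [inner_smul_right, real_inner_self_eq_norm_sq, norm_smul, Real.norm_of_nonneg ht0.le]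
    have h1 : t * (‖y‖ * (‖y‖ - c)) = |B| + 1 := div_mul_cancel₀ _ hpos.ne'
    linarith
  refine lt_of_lt_of_le ?_ (le_iSup _ (t • y))
  rw [scaledNorm, ← EReal.coe_sub, hval, EReal.coe_lt_coe_iff]
  linarith [le_abs_self B]

theorem effDom_fenchelConj_scaledNorm {c : ℝ} (hc : 0 ≤ c) :
    effDom (fenchelConj (scaledNorm (E := E) c)) = {y | ‖y‖ ≤ c} := by
  ext y
  simp only [effDom, Set.mem_ofPred_eq]
  rcases le_or_gt ‖y‖ c with h | h
  · simp [fenchelConj_scaledNorm_of_le h, h]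
  · simp [fenchelConj_scaledNorm_of_lt hc h, h]

/-- Nontriviality provides a vector of norm exactly `c`; in the zero space the supremum would be
`0`. -/
theorem isDualRadius_scaledNorm {k : ℕ} [Nontrivial (Point k)] {c : ℝ} (hc : 0 ≤ c) :
    IsDualRadius (k := k) c (c ^ 2 / 2) := by
  rw [IsDualRadius, effDom_fenchelConj_scaledNorm hc]
  constructor
  · rintro _ ⟨z, hz, rfl⟩
    have hz' : ‖z‖ ≤ c := hz
    simp only [bregman_halfSq, sub_zero]
    nlinarith [norm_nonneg z]
  · intro b hb
    obtain ⟨z, hz⟩ := exists_norm_eq (Point k) hc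
    have := hb ⟨z, hz.le, rfl⟩
    simp only [bregman_halfSq, sub_zero, hz] at this
    linarith

/-- `φ` has constant curvature `κ` along every segment. -/
def HasCurvature (κ : ℝ) (φ : E → ℝ) : Prop :=
  ∀ x y (t : ℝ), φ (x + t • (y - x)) = (1 - t) * φ x + t * φ y - t * (1 - t) * (κ / 2) * ‖y - x‖ ^ 2

theorem hasCurvature_inner (p : E) : HasCurvature 0 (fun w => ⟪p, w⟫_ℝ) := by
  intro x y t
  simp only [inner_add_right, inner_smul_right, inner_sub_right]
  ring

theorem hasCurvature_half_norm_sq (c : E) :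
    HasCurvature 1 (fun w => 1 / 2 * ‖w - c‖ ^ 2) := by
  intro x y t
  have h1 : x + t • (y - x) - c = (x - c) + t • ((y - c) - (x - c)) := by
    rw [sub_sub_sub_cancel_right]; abel
  have h2 : y - x = (y - c) - (x - c) := by abel
  simp only [h1]
  rw [h2]
  generalize x - c = a
  generalize y - c = b
  rw [norm_add_sq_real, norm_smul, inner_smul_right, mul_pow, Real.norm_eq_abs, sq_abs,
    norm_sub_sq_real, inner_sub_right, real_inner_self_eq_norm_sq, real_inner_comm]
  ring

theorem HasCurvature.add {κ κ' : ℝ} {φ ψ : E → ℝ} (hφ : HasCurvature κ φ)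
    (hψ : HasCurvature κ' ψ) : HasCurvature (κ + κ') (fun w => φ w + ψ w) := by
  intro x y t
  simp only [hφ x y t, hψ x y t]
  ring

theorem HasCurvature.const_mul {κ : ℝ} {φ : E → ℝ} (hφ : HasCurvature κ φ) (a : ℝ) :
    HasCurvature (a * κ) (fun w => a * φ w) := by
  intro x y t
  simp only [hφ x y t]
  ring

theorem HasCurvature.sum {ι : Type*} (s : Finset ι) {κ : ι → ℝ} {φ : ι → E → ℝ}
    (hφ : ∀ i, HasCurvature (κ i) (φ i)) :
    HasCurvature (∑ i ∈ s, κ i) (fun w => ∑ i ∈ s, φ i w) := by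
  classical
  induction s using Finset.induction_on with
  | empty => intro x y t; simp
  | insert a s ha ih =>
    simp only [Finset.sum_insert ha]
    exact (hφ a).add ih

/-- Compare `u` with points of the segment towards `w`: dividing by `t` leaves `(1 - t) * (κ / 2 *
‖w - u‖ ^ 2) ≤ φ w - φ u`, and `t` can be taken small. No derivative is needed, so the same argument
serves the primal and the dual proximal steps. -/
theorem HasCurvature.le_of_isMinOn {κ : ℝ} {φ : E → ℝ} (hφ : HasCurvature κ φ) {U : Set E}
    (hU : Convex ℝ U) {u w : E} (hu : u ∈ U) (hmin : IsMinOn φ U u) (hw : w ∈ U) :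
    φ u + κ / 2 * ‖w - u‖ ^ 2 ≤ φ w := by
  by_contra! hlt
  have h0 : φ u ≤ φ w := hmin hw
  have hc : 0 < κ / 2 * ‖w - u‖ ^ 2 := by linarith
  have key : ∀ t : ℝ, 0 < t → t ≤ 1 → (1 - t) * (κ / 2 * ‖w - u‖ ^ 2) ≤ φ w - φ u := by
    intro t ht ht1
    have hmem : u + t • (w - u) ∈ U := hU.add_smul_sub_mem hu hw ⟨ht.le, ht1⟩
    have h1 : φ u ≤ φ (u + t • (w - u)) := hmin hmem
    rw [hφ u w t] at h1
    refine le_of_mul_le_mul_left ?_ ht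
    linarith
  set c := κ / 2 * ‖w - u‖ ^ 2
  -- Half the relative deficit: for this `t` the left side of `key` is `c` minus only half of the
  -- deficit, hence still larger than `φ w - φ u`.
  have h2 := key ((c - (φ w - φ u)) / (2 * c)) (by apply div_pos <;> linarith)
    (by rw [div_le_one (by linarith)]; linarith)
  have h3 : (1 - (c - (φ w - φ u)) / (2 * c)) * c = c - (c - (φ w - φ u)) / 2 := by
    field_simp
  linarith

end General

/-! ### The inner loop: one primal update by gradient sliding. -/

section Sliding

variable {E : Type*} [NormedAddCommGroup E] [InnerProductSpace ℝ E]

theorem sum_Icc_add_one_weights (T : ℕ) :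
    ∑ t ∈ Finset.Icc 1 T, ((t : ℝ) + 1) = (T : ℝ) * (T + 3) / 2 := by
  induction T with
  | zero => simp
  | succ n ih =>
    rw [Finset.sum_Icc_succ_top (by omega), ih]
    push_cast
    ring

/-- Only `F` is linearized; the linear term and the proximal terms at the centers stay exact and
contribute curvature `∑ η i`. The weights `t + 1` make the inner steps telescope, and Jensen's
inequality passes to `uhat`. The term with factor `2 / (T * (T + 3))` is the price of starting at
`x₀`; it telescopes in the outer loop. -/
theorem IsGradientSliding.exists_bound {ι : Type*} [Fintype ι] {F : E → ℝ} {F' : E → E} {U : Set E}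
    {M : ℝ} (hU : Convex ℝ U) (hconv : ConvexOn ℝ U F)
    (hlow : ∀ X ∈ U, ∀ X' ∈ U, 0 ≤ F X - F X' - ⟪F' X', X - X'⟫_ℝ)
    (hup : ∀ X ∈ U, ∀ X' ∈ U, F X - F X' - ⟪F' X', X - X'⟫_ℝ ≤ M * ‖X - X'‖)
    {D : E → E → ℝ} (hD : ∀ x z, D x z = 1 / 2 * ‖x - z‖ ^ 2) {T : ℕ} (hT : 1 ≤ T) {η : ι → ℝ}
    (hη0 : 0 < ∑ i, η i) {v : E} {c : ι → E} {x₀ uT uhat : E} (hx₀ : x₀ ∈ U)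
    (h : IsGradientSliding F' U D (fun t => (t : ℝ) + 1) (fun t => (t : ℝ) / 2) T η v c x₀ uT uhat) :
    uT ∈ U ∧ uhat ∈ U ∧ ∀ x ∈ U,
      F uhat + ⟪v, uhat⟫_ℝ + ∑ i, η i * (1 / 2 * ‖uhat - c i‖ ^ 2)
        + (∑ i, η i) * (1 / 2 * ‖x - uT‖ ^ 2)
        + (∑ i, η i) * (2 / (T * (T + 3))) * (1 / 2 * ‖x - uT‖ ^ 2)
      ≤ F x + ⟪v, x⟫_ℝ + ∑ i, η i * (1 / 2 * ‖x - c i‖ ^ 2)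
        + (∑ i, η i) * (2 / (T * (T + 3))) * (1 / 2 * ‖x - x₀‖ ^ 2)
        + 4 * M ^ 2 / ((∑ i, η i) * (T + 3)) := by
  obtain ⟨u, hu0, hu, huT, huhat⟩ := h
  set e := ∑ i, η i with he
  have hmem : ∀ t ≤ T, u t ∈ U := by
    intro t ht
    rcases Nat.eq_zero_or_pos t with rfl | h0
    · rw [hu0]; exact hx₀
    · exact (hu t (Finset.mem_Icc.2 ⟨h0, ht⟩)).1
  have hT0 : (0 : ℝ) < T := by exact_mod_cast hT
  set W : ℝ := ∑ t ∈ Finset.Icc 1 T, ((t : ℝ) + 1) with hW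
  have hWval : W = (T : ℝ) * (T + 3) / 2 := sum_Icc_add_one_weights T
  have hW0 : 0 < W := by rw [hWval]; positivity
  have hcm : uhat = (Finset.Icc 1 T).centerMass (fun t => (t : ℝ) + 1) u := huhat
  have hmemI : ∀ t ∈ Finset.Icc 1 T, u t ∈ U := fun t ht => hmem t (Finset.mem_Icc.1 ht).2
  have hw0 : ∀ t ∈ Finset.Icc 1 T, (0 : ℝ) ≤ (t : ℝ) + 1 := fun t _ => by positivity
  have huhatU : uhat ∈ U := by
    rw [hcm]; exact hU.centerMass_mem hw0 hW0 hmemI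
  refine ⟨huT ▸ hmem T le_rfl, huhatU, fun x hx => ?_⟩
  set q : E → ℝ := fun w => ⟪v, w⟫_ℝ + ∑ i, η i * (1 / 2 * ‖w - c i‖ ^ 2) with hq
  have hqcurv : HasCurvature (0 + ∑ i, η i * 1) q :=
    (hasCurvature_inner v).add
      (HasCurvature.sum _ fun i => (hasCurvature_half_norm_sq (c i)).const_mul (η i))
  simp only [mul_one, zero_add] at hqcurv
  have hqconv : ConvexOn ℝ U q := by
    refine ⟨hU, fun a _ b _ s t hs ht hst => ?_⟩
    obtain rfl : s = 1 - t := by linarith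
    have h1 : (1 - t) • a + t • b = a + t • (b - a) := by
      rw [sub_smul, one_smul, smul_sub]; abel
    rw [h1, hqcurv a b t, smul_eq_mul, smul_eq_mul]
    have : 0 ≤ t * (1 - t) * (e / 2) * ‖b - a‖ ^ 2 := by positivity
    linarith
  set Φ : E → ℝ := fun w => F w + q w with hΦ
  have hΦconv : ConvexOn ℝ U Φ := hconv.add hqconv
  -- one sliding step
  have hstep : ∀ t ∈ Finset.Icc 1 T, ((t : ℝ) + 1) * (Φ (u t) - Φ x)
      ≤ e * ((t : ℝ) * (t + 1) / 2) * (1 / 2 * ‖x - u (t - 1)‖ ^ 2)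
        - e * (((t : ℝ) + 1) * (t + 2) / 2) * (1 / 2 * ‖x - u t‖ ^ 2) + 2 * M ^ 2 / e := by
    intro t ht
    obtain ⟨htU, htmin⟩ := hu t ht
    have ht1 := (Finset.mem_Icc.1 ht)
    have htpos : (1 : ℝ) ≤ t := by exact_mod_cast ht1.1
    have hprevU : u (t - 1) ∈ U := hmem _ (by omega)
    simp only [hD] at htmin
    have hcurv := ((hasCurvature_inner (v + F' (u (t - 1)))).add
      (HasCurvature.sum Finset.univ
        fun i => (hasCurvature_half_norm_sq (c i)).const_mul (η i))).add
      ((hasCurvature_half_norm_sq (u (t - 1))).const_mul (e * (t / 2)))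
    have h3 := hcurv.le_of_isMinOn hU htU htmin hx
    simp only [mul_one, zero_add, ← he, inner_add_left] at h3
    have h4 := hlow x hx (u (t - 1)) hprevU
    have h5 := hup (u t) htU (u (t - 1)) hprevU
    rw [inner_sub_right] at h4 h5
    -- The linearization error is only Lipschitz, so it is traded against the proximal term at the
    -- previous inner iterate by completing a square.
    have h6 : M * ‖u t - u (t - 1)‖
        ≤ e * (t / 2) * (1 / 2 * ‖u t - u (t - 1)‖ ^ 2) + M ^ 2 / (e * t) := by
      have : 0 ≤ e * t * (‖u t - u (t - 1)‖ / 2 - M / (e * t)) ^ 2 := by positivity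
      have h7 : e * t * (‖u t - u (t - 1)‖ / 2 - M / (e * t)) ^ 2
          = e * (t / 2) * (1 / 2 * ‖u t - u (t - 1)‖ ^ 2) + M ^ 2 / (e * t)
            - M * ‖u t - u (t - 1)‖ := by
        field_simp
        ring
      linarith
    have h8 : Φ (u t) - Φ x ≤ e * (t / 2) * (1 / 2 * ‖x - u (t - 1)‖ ^ 2)
        - e * (1 + t / 2) * (1 / 2 * ‖x - u t‖ ^ 2) + M ^ 2 / (e * t) := by
      simp only [hΦ, hq]
      linarith
    have h9 : ((t : ℝ) + 1) * (M ^ 2 / (e * t)) ≤ 2 * M ^ 2 / e := by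
      have h10 : 2 * M ^ 2 / e - ((t : ℝ) + 1) * (M ^ 2 / (e * t)) = M ^ 2 * (t - 1) / (e * t) := by
        field_simp
        ring
      have h11 : 0 ≤ M ^ 2 * ((t : ℝ) - 1) / (e * t) :=
        div_nonneg (mul_nonneg (sq_nonneg _) (by linarith)) (by positivity)
      linarith
    -- After this multiplication the distance coefficients are `t(t+1)/2` and `(t+1)(t+2)/2`,
    -- consecutive values of one sequence.
    have h12 := mul_le_mul_of_nonneg_left h8 (by linarith : (0 : ℝ) ≤ (t : ℝ) + 1)
    linarith
  -- telescoping
  have htel : ∀ n : ℕ, n ≤ T → ∑ t ∈ Finset.Icc 1 n, ((t : ℝ) + 1) * (Φ (u t) - Φ x)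
      ≤ e * (1 / 2 * ‖x - x₀‖ ^ 2)
        - e * (((n : ℝ) + 1) * (n + 2) / 2) * (1 / 2 * ‖x - u n‖ ^ 2) + n * (2 * M ^ 2 / e) := by
    intro n
    induction n with
    | zero =>
      intro _
      simp [hu0]
    | succ n ih =>
      intro hn
      have h1 := ih (by omega)
      have h2 := hstep (n + 1) (Finset.mem_Icc.2 ⟨by omega, hn⟩)
      rw [Finset.sum_Icc_succ_top (by omega)]
      simp only [Nat.add_sub_cancel] at h2
      push_cast at h2 ⊢
      linarith
  have hsum := htel T le_rfl
  have hjensen : W * Φ uhat ≤ ∑ t ∈ Finset.Icc 1 T, ((t : ℝ) + 1) * Φ (u t) := by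
    have h1 := hΦconv.map_centerMass_le hw0 hW0 hmemI
    rw [← hcm, Finset.centerMass, ← hW, smul_eq_mul, inv_mul_eq_div, le_div_iff₀ hW0] at h1
    simp only [Function.comp, smul_eq_mul] at h1
    linarith
  have hsplit : ∑ t ∈ Finset.Icc 1 T, ((t : ℝ) + 1) * (Φ (u t) - Φ x)
      = ∑ t ∈ Finset.Icc 1 T, ((t : ℝ) + 1) * Φ (u t) - W * Φ x := by
    rw [hW, Finset.sum_mul, ← Finset.sum_sub_distrib]
    exact Finset.sum_congr rfl fun _ _ => by ring
  have hmain : W * (Φ uhat - Φ x) ≤ e * (1 / 2 * ‖x - x₀‖ ^ 2)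
        - e * (((T : ℝ) + 1) * (T + 2) / 2) * (1 / 2 * ‖x - uT‖ ^ 2) + T * (2 * M ^ 2 / e) := by
    rw [huT]; linarith
  have hdiv : Φ uhat - Φ x ≤ (e * (1 / 2 * ‖x - x₀‖ ^ 2)
        - e * (((T : ℝ) + 1) * (T + 2) / 2) * (1 / 2 * ‖x - uT‖ ^ 2) + T * (2 * M ^ 2 / e)) / W := by
    rw [le_div_iff₀ hW0]; linarith
  -- Uses `(T+1)(T+2) = T(T+3) + 2`: division by `W = T(T+3)/2` leaves a full distance term plus the
  -- small restart term.
  have hrhs : (e * (1 / 2 * ‖x - x₀‖ ^ 2)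
        - e * (((T : ℝ) + 1) * (T + 2) / 2) * (1 / 2 * ‖x - uT‖ ^ 2) + T * (2 * M ^ 2 / e)) / W
      = e * (2 / (T * (T + 3))) * (1 / 2 * ‖x - x₀‖ ^ 2)
        - e * (1 / 2 * ‖x - uT‖ ^ 2) - e * (2 / (T * (T + 3))) * (1 / 2 * ‖x - uT‖ ^ 2)
        + 4 * M ^ 2 / (e * (T + 3)) := by
    rw [hWval]
    field_simp
    ring
  rw [hrhs] at hdiv
  simp only [hΦ, hq] at hdiv
  linarith

end Sliding

/-! ### Sums with a lag. -/

section Telescoping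

theorem sum_Ico_int_eq_sum_range {A : Type*} [AddCommMonoid A] (g : ℤ → A) (a : ℤ) (r : ℕ) :
    ∑ k ∈ Finset.Ico a (a + r), g k = ∑ j ∈ Finset.range r, g (a + j) := by
  symm
  refine Finset.sum_bij (fun j _ => a + (j : ℤ)) ?_ ?_ ?_ ?_
  · intro j hj
    have := Finset.mem_range.1 hj
    exact Finset.mem_Ico.2 ⟨by omega, by omega⟩
  · intro i _ j _ h
    simpa using h
  · intro k hk
    have := Finset.mem_Ico.1 hk
    exact ⟨(k - a).toNat, Finset.mem_range.2 (by omega), by omega⟩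
  · intros; rfl

/-- With lag `r` the sum collapses to an initial window of `r` terms, all equal to `φ₀`, minus a
nonnegative final window. -/
theorem sum_range_shift_sub_le {φ : ℤ → ℝ} {φ₀ : ℝ} (hφ : ∀ k, 0 ≤ φ k)
    (hneg : ∀ k < 0, φ k = φ₀) (r n : ℕ) :
    ∑ k ∈ Finset.range n, (φ ((k : ℤ) - r) - φ k) ≤ r * φ₀ := by
  have key : ∑ k ∈ Finset.range n, (φ ((k : ℤ) - r) - φ k)
      = r * φ₀ - ∑ j ∈ Finset.range r, φ ((n : ℤ) - r + j) := by
    induction n with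
    | zero =>
      have : ∑ j ∈ Finset.range r, φ (((0 : ℕ) : ℤ) - r + j) = ∑ j ∈ Finset.range r, φ₀ :=
        Finset.sum_congr rfl fun j hj => hneg _ (by have := Finset.mem_range.1 hj; omega)
      rw [this]
      simp
    | succ n ih =>
      rw [Finset.sum_range_succ, ih]
      have h1 := Finset.sum_range_succ (fun j : ℕ => φ ((n : ℤ) - r + j)) r
      have h2 := Finset.sum_range_succ' (fun j : ℕ => φ ((n : ℤ) - r + j)) r
      have h3 : ∑ j ∈ Finset.range r, φ ((n : ℤ) - r + ((j + 1 : ℕ) : ℤ))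
          = ∑ j ∈ Finset.range r, φ (((n + 1 : ℕ) : ℤ) - r + j) :=
        Finset.sum_congr rfl fun j _ => by congr 1; push_cast; ring
      rw [h3] at h2
      simp only [sub_add_cancel, Nat.cast_zero, add_zero] at h1 h2
      linarith
  rw [key]
  have := Finset.sum_nonneg fun j (_ : j ∈ Finset.range r) => hφ ((n : ℤ) - r + j)
  linarith

end Telescoping

/-! ### Bilinear terms of one dual block. -/

section Block

variable {E H : Type*} [NormedAddCommGroup E] [InnerProductSpace ℝ E]
  [NormedAddCommGroup H] [InnerProductSpace ℝ H]

theorem inner_map_le_young (K : E →L[ℝ] H) {a : ℝ} (ha : 0 < a) (q : E) (w : H) :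
    ⟪K q, w⟫_ℝ ≤ a / 2 * ‖q‖ ^ 2 + ‖K‖ ^ 2 / (2 * a) * ‖w‖ ^ 2 := by
  have h1 : ⟪K q, w⟫_ℝ ≤ ‖K‖ * ‖q‖ * ‖w‖ :=
    (real_inner_le_norm _ _).trans (mul_le_mul_of_nonneg_right (K.le_opNorm q) (norm_nonneg w))
  have h2 : 0 ≤ a / 2 * (‖q‖ - ‖K‖ * ‖w‖ / a) ^ 2 := by positivity
  have h3 : a / 2 * (‖q‖ - ‖K‖ * ‖w‖ / a) ^ 2
      = a / 2 * ‖q‖ ^ 2 + ‖K‖ ^ 2 / (2 * a) * ‖w‖ ^ 2 - ‖K‖ * ‖q‖ * ‖w‖ := by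
    field_simp
    ring
  linarith

theorem norm_sum_range_sq_le {G : Type*} [SeminormedAddCommGroup G] (r : ℕ) (g : ℕ → G) :
    ‖∑ j ∈ Finset.range r, g j‖ ^ 2 ≤ r * ∑ j ∈ Finset.range r, ‖g j‖ ^ 2 := by
  calc ‖∑ j ∈ Finset.range r, g j‖ ^ 2 ≤ (∑ j ∈ Finset.range r, ‖g j‖) ^ 2 := by
        gcongr; exact norm_sum_le _ _
    _ ≤ _ := by simpa using sq_sum_le_card_mul_sum_sq (s := Finset.range r) (f := fun j => ‖g j‖)

/-- The bilinear terms of one dual block over `n` of its updates. -/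
theorem sum_block_inner_le (K : E →L[ℝ] H) {X Xhat : ℤ → E} {x₀ : E} {y : ℤ → H}
    (hneg : ∀ k < 0, X k = x₀ ∧ Xhat k = x₀) (hy : y (-1) = 0) {r : ℕ} (hr : 0 < r) {e : ℝ}
    (he : 0 < e) (z : H) (n : ℕ)
    (hdual : ∀ i : ℕ, i < n →
      ⟪K (∑ j ∈ Finset.range r, (Xhat (r * i - r + j) - X (r * i - r + j - r) + X (r * i - r + j))),
        z - y i⟫_ℝ
      ≤ r * (2 * ‖K‖ ^ 2 / e) * (1 / 2 * ‖z - y (i - 1)‖ ^ 2 - 1 / 2 * ‖z - y i‖ ^ 2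
          - 1 / 2 * ‖y i - y (i - 1)‖ ^ 2)) :
    ∑ k ∈ Finset.range (r * n), ⟪K (Xhat k), z - y ((k : ℤ) / r)⟫_ℝ
      ≤ r * (2 * ‖K‖ ^ 2 / e) * (1 / 2 * ‖z‖ ^ 2)
        + ∑ k ∈ Finset.range (r * n), e * (1 / 2 * ‖Xhat k - X ((k : ℤ) - r)‖ ^ 2) := by
  have hr0 : (0 : ℝ) < r := by exact_mod_cast hr
  -- `q i` is the mismatch accumulated over the `i`-th window. The window sum of `Xhat` equals `q l
  -- - q (l - 1)` plus the extrapolated point used in the dual update, so only differences of `q`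
  -- are left to telescope.
  set q : ℤ → E := fun i => ∑ j ∈ Finset.range r, (Xhat (r * i + j) - X (r * i + j - r)) with hq
  have hqneg : q (-1) = 0 := by
    refine Finset.sum_eq_zero fun j hj => ?_
    have := Finset.mem_range.1 hj
    rw [(hneg _ (by omega : (r : ℤ) * (-1) + j < 0)).2,
      (hneg _ (by omega : (r : ℤ) * (-1) + j - r < 0)).1, sub_self]
  set C : ℝ := r * (2 * ‖K‖ ^ 2 / e) with hC
  have hyoung : ∀ (p : E) (w : H),
      ⟪K p, w⟫_ℝ ≤ e / r / 2 * ‖p‖ ^ 2 + C * (1 / 2 * ‖w‖ ^ 2) := by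
    intro p w
    have h1 := inner_map_le_young K (div_pos he hr0) p w
    have h2 : C * (1 / 2 * ‖w‖ ^ 2) - ‖K‖ ^ 2 / (2 * (e / r)) * ‖w‖ ^ 2
        = ‖K‖ ^ 2 * r / (2 * e) * ‖w‖ ^ 2 := by
      rw [hC]; field_simp; ring
    have h3 : 0 ≤ ‖K‖ ^ 2 * r / (2 * e) * ‖w‖ ^ 2 := by positivity
    linarith
  -- The invariant holds back the quadratic term of the latest window: the next step, or the final
  -- estimate, spends it on the pending product with `q (l - 1)`.
  have hinv : ∀ l : ℕ, l ≤ n →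
      ∑ k ∈ Finset.range (r * l), ⟪K (Xhat k), z - y ((k : ℤ) / r)⟫_ℝ
        + e / r / 2 * ‖q ((l : ℤ) - 1)‖ ^ 2
      ≤ ⟪K (q ((l : ℤ) - 1)), z - y ((l : ℤ) - 1)⟫_ℝ
        + C * (1 / 2 * ‖z‖ ^ 2 - 1 / 2 * ‖z - y ((l : ℤ) - 1)‖ ^ 2)
        + ∑ k ∈ Finset.range (r * l), e * (1 / 2 * ‖Xhat k - X ((k : ℤ) - r)‖ ^ 2) := by
    intro l
    induction l with
    | zero =>
      intro _
      simp [hqneg, hy]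
    | succ l ih =>
      intro hl
      have h1 := ih (by omega)
      have h2 := hdual l (by omega)
      have hcast : ((l + 1 : ℕ) : ℤ) - 1 = l := by push_cast; ring
      rw [hcast, Nat.mul_succ, Finset.sum_range_add, Finset.sum_range_add]
      have hblock : ∑ j ∈ Finset.range r,
          ⟪K (Xhat ((r * l + j : ℕ) : ℤ)), z - y (((r * l + j : ℕ) : ℤ) / r)⟫_ℝ
          = ⟪K (∑ j ∈ Finset.range r, Xhat (r * l + j)), z - y l⟫_ℝ := by
        rw [map_sum, sum_inner]
        refine Finset.sum_congr rfl fun j hj => ?_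
        have hj' := Finset.mem_range.1 hj
        have hdiv : ((r * l + j : ℕ) : ℤ) / r = l := by
          have : (r * l + j) / r = l := by
            rw [Nat.mul_add_div hr, Nat.div_eq_of_lt hj', add_zero]
          exact_mod_cast this
        rw [hdiv]
        push_cast
        rfl
      have hsplit : ∑ j ∈ Finset.range r, Xhat ((r : ℤ) * l + j)
          = q l - q ((l : ℤ) - 1) + ∑ j ∈ Finset.range r,
            (Xhat (r * l - r + j) - X (r * l - r + j - r) + X (r * l - r + j)) := by
        simp only [hq, ← Finset.sum_sub_distrib, ← Finset.sum_add_distrib]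
        refine Finset.sum_congr rfl fun j _ => ?_
        have e1 : (r : ℤ) * (l - 1) + j = r * l - r + j := by ring
        have e2 : (r : ℤ) * l + j - r = r * l - r + j := by ring
        rw [e1, e2]
        abel
      -- Cauchy-Schwarz over a window of `r` terms; this loss of `r` is why Young's inequality is
      -- used with parameter `e / r`.
      have hsq : e / r / 2 * ‖q l‖ ^ 2 ≤ ∑ j ∈ Finset.range r,
          e * (1 / 2 * ‖Xhat ((r * l + j : ℕ) : ℤ) - X (((r * l + j : ℕ) : ℤ) - r)‖ ^ 2) := by
        have h3 := norm_sum_range_sq_le r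
          (fun j => Xhat ((r : ℤ) * l + j) - X ((r : ℤ) * l + j - r))
        calc e / r / 2 * ‖q l‖ ^ 2
            ≤ e / r / 2 * (r * ∑ j ∈ Finset.range r,
                ‖Xhat ((r : ℤ) * l + j) - X ((r : ℤ) * l + j - r)‖ ^ 2) := by gcongr
          _ = _ := by
            rw [← Finset.mul_sum, ← Finset.mul_sum]
            push_cast
            field_simp
      have h4 := hyoung (q ((l : ℤ) - 1)) (y l - y ((l : ℤ) - 1))
      rw [hblock, hsplit, map_add, inner_add_left, map_sub, inner_sub_left]
      have h5 : ⟪K (q ((l : ℤ) - 1)), z - y ((l : ℤ) - 1)⟫_ℝ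
          = ⟪K (q ((l : ℤ) - 1)), z - y l⟫_ℝ
            + ⟪K (q ((l : ℤ) - 1)), y l - y ((l : ℤ) - 1)⟫_ℝ := by
        rw [← inner_add_right]; congr 1; abel
      linarith
  have h1 := hinv n le_rfl
  have h2 := hyoung (q ((n : ℤ) - 1)) (z - y ((n : ℤ) - 1))
  linarith

end Block

/-! ### The primal-dual gap summed over the run. -/

section Gap

variable {E : Type*} [NormedAddCommGroup E] [InnerProductSpace ℝ E]

/-- The conjugate is the indicator of a ball, so the extended-real minimization is a minimization of
`ψ` over that ball. -/
theorem le_of_isMinOn_add_fenchelConj {c : ℝ} (hc : 0 ≤ c) {ψ : E → ℝ} {κ : ℝ}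
    (hψ : HasCurvature κ ψ) {y z : E}
    (hmin : IsMinOn (fun w => (ψ w : EReal) + fenchelConj (scaledNorm c) w) Set.univ y)
    (hz : ‖z‖ ≤ c) : ψ y + κ / 2 * ‖z - y‖ ^ 2 ≤ ψ z := by
  have hle : ∀ w : E, ‖w‖ ≤ c →
      (ψ y : EReal) + fenchelConj (scaledNorm c) y ≤ (ψ w : EReal) := by
    intro w hw
    have h1 := hmin (Set.mem_univ w)
    simpa [fenchelConj_scaledNorm_of_le hw] using h1
  have hy : ‖y‖ ≤ c := by
    by_contra! hlt
    have h1 := hle 0 (by simpa using hc)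
    rw [fenchelConj_scaledNorm_of_lt hc hlt, EReal.coe_add_top] at h1
    exact absurd h1 (by simp)
  refine hψ.le_of_isMinOn (convex_closedBall (0 : E) c) (u := y) (by simpa using hy) ?_
    (by simpa using hz)
  intro w hw
  have h1 := hle w (by simpa using hw)
  rw [fenchelConj_scaledNorm_of_le hy, add_zero] at h1
  exact_mod_cast h1

variable {S : ℕ} {H : Fin S → Type*} [∀ s, NormedAddCommGroup (H s)]
  [∀ s, InnerProductSpace ℝ (H s)] [CompleteSpace E] [∀ s, CompleteSpace (H s)]

theorem norm_adjoint_eq {G : Type*} [NormedAddCommGroup G] [InnerProductSpace ℝ G]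
    [CompleteSpace G] (A : E →L[ℝ] G) : ‖A.adjoint‖ = ‖A‖ :=
  LinearIsometryEquiv.norm_map ContinuousLinearMap.adjoint A

theorem IsRun.dual_step {K : ∀ s, E →L[ℝ] H s} {Dy ρ c : Fin S → ℝ} {DX : ℝ} {r : Fin S → ℕ}
    {T N : ℕ} {U : Set E} {F' : E → E} {wX : E → ℝ} {x₀ : E} {X Xhat : ℤ → E}
    {y : ∀ s, ℤ → H s}
    (hrun : IsRun (convexParams K Dy DX ρ r T) N U F' K (fun s => fenchelConj (scaledNorm (c s)))
      wX (fun _ => halfSq) x₀ (fun _ => 0) X Xhat y)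
    (hc : ∀ s, 0 ≤ c s) (hr : ∀ s, 0 < r s) (s : Fin S) (i : ℕ) (hi : r s * i ≤ N) {z : H s}
    (hz : ‖z‖ ≤ c s) :
    ⟪K s (∑ j ∈ Finset.range (r s),
        (Xhat (r s * i - r s + j) - X (r s * i - r s + j - r s) + X (r s * i - r s + j))),
        z - y s i⟫_ℝ
      ≤ r s * (2 * ‖K s‖ ^ 2 / (etaBase K Dy DX * ρ s)) * (1 / 2 * ‖z - y s (i - 1)‖ ^ 2
          - 1 / 2 * ‖z - y s i‖ ^ 2 - 1 / 2 * ‖y s i - y s (i - 1)‖ ^ 2) := by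
  have hr0 : (0 : ℝ) < r s := by exact_mod_cast hr s
  have hmin := hrun.dual_update s i (by positivity)
    (by simp only [convexParams]; exact_mod_cast hi)
  have hext : extrapolate (convexParams K Dy DX ρ r T) X Xhat s i = ∑ j ∈ Finset.range (r s),
      (Xhat (r s * i - r s + j) - X (r s * i - r s + j - r s) + X (r s * i - r s + j)) := by
    have h1 : Finset.Ico ((r s : ℤ) * i - r s) (r s * i)
        = Finset.Ico ((r s : ℤ) * i - r s) (r s * i - r s + r s) := by rw [sub_add_cancel]
    simp only [extrapolate, convexParams, one_smul]
    rw [h1, ← Finset.sum_add_distrib, sum_Ico_int_eq_sum_range]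
  rw [hext] at hmin
  have hθ : (∑ _k ∈ Finset.Ico ((r s : ℤ) * i) (r s * i + r s), (1 : ℝ)) = r s := by
    simp
  simp only [convexParams, hθ, bregman_halfSq, norm_adjoint_eq] at hmin
  set p := ∑ j ∈ Finset.range (r s),
      (Xhat (r s * i - r s + j) - X (r s * i - r s + j - r s) + X (r s * i - r s + j))
  have h2 := le_of_isMinOn_add_fenchelConj (hc s)
    ((hasCurvature_inner (-((r s : ℝ)⁻¹ • K s p))).add
      ((hasCurvature_half_norm_sq (y s (i - 1))).const_mul
        (2 * ‖K s‖ ^ 2 / (ρ s * etaBase K Dy DX)))) hmin hz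
  simp only [inner_neg_left, real_inner_smul_left, mul_one, zero_add] at h2
  rw [mul_comm (ρ s)] at h2
  have h3 := mul_le_mul_of_nonneg_left h2 hr0.le
  have h4 : ∀ w : H s, (r s : ℝ) * ((r s : ℝ)⁻¹ * ⟪K s p, w⟫_ℝ) = ⟪K s p, w⟫_ℝ := fun w => by
    rw [← mul_assoc, mul_inv_cancel₀ hr0.ne', one_mul]
  rw [inner_sub_right]
  linarith [h4 z, h4 (y s i)]

/-- The comparison point satisfies `K s x = 0`, so its products with the dual iterates vanish and
only those with `Xhat` remain, to be handled block by block. -/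
theorem IsRun.sum_gap_le {K : ∀ s, E →L[ℝ] H s} {Dy ρ c : Fin S → ℝ} {DX M : ℝ} {r : Fin S → ℕ}
    {T N : ℕ} {U : Set E} {F : E → ℝ} {F' : E → E} {wX : E → ℝ} {x₀ : E} {X Xhat : ℤ → E}
    {y : ∀ s, ℤ → H s}
    (hrun : IsRun (convexParams K Dy DX ρ r T) N U F' K (fun s => fenchelConj (scaledNorm (c s)))
      wX (fun _ => halfSq) x₀ (fun _ => 0) X Xhat y)
    (hU : Convex ℝ U) (hconv : ConvexOn ℝ U F)
    (hlow : ∀ X ∈ U, ∀ X' ∈ U, 0 ≤ F X - F X' - ⟪F' X', X - X'⟫_ℝ)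
    (hup : ∀ X ∈ U, ∀ X' ∈ U, F X - F X' - ⟪F' X', X - X'⟫_ℝ ≤ M * ‖X - X'‖)
    (hw : ∀ x z, bregman wX x z = 1 / 2 * ‖x - z‖ ^ 2) (hx₀ : x₀ ∈ U)
    (hρ : ∀ s, 0 < ρ s) (hρ1 : ∑ s, ρ s = 1) (hη : 0 < etaBase K Dy DX)
    (hc : ∀ s, 0 ≤ c s) (hr : ∀ s, 0 < r s) (hN : ∀ s, r s ∣ N + 1) (hT : 1 ≤ T) :
    (∀ k : ℕ, k ≤ N → Xhat k ∈ U) ∧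
    ∀ x ∈ U, (∀ s, K s x = 0) → ∀ z : ∀ s, H s, (∀ s, ‖z s‖ ≤ c s) →
      ∑ k ∈ Finset.range (N + 1), (F (Xhat k) - F x + ∑ s, ⟪K s (Xhat k), z s⟫_ℝ)
      ≤ etaBase K Dy DX * (rbar r ρ + 2 / (T * (T + 3))) * (1 / 2 * ‖x - x₀‖ ^ 2)
        + (N + 1) * (4 * M ^ 2 / (etaBase K Dy DX * (T + 3)))
        + ∑ s, r s * (2 * ‖K s‖ ^ 2 / (etaBase K Dy DX * ρ s)) * (1 / 2 * ‖z s‖ ^ 2) := by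
  set η := etaBase K Dy DX with hηdef
  have hsumη : ∑ s, η * ρ s = η := by rw [← Finset.mul_sum, hρ1, mul_one]
  have hprimal : ∀ k : ℕ, k ≤ N → X ((k : ℤ) - 1) ∈ U → X k ∈ U ∧ Xhat k ∈ U ∧ ∀ x ∈ U,
      F (Xhat k) + ⟪∑ s, (K s).adjoint (y s ((k : ℤ) / r s)), Xhat k⟫_ℝ
        + ∑ s, η * ρ s * (1 / 2 * ‖Xhat k - X (k - r s)‖ ^ 2)
        + η * (1 / 2 * ‖x - X k‖ ^ 2) + η * (2 / (T * (T + 3))) * (1 / 2 * ‖x - X k‖ ^ 2)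
      ≤ F x + ⟪∑ s, (K s).adjoint (y s ((k : ℤ) / r s)), x⟫_ℝ
        + ∑ s, η * ρ s * (1 / 2 * ‖x - X (k - r s)‖ ^ 2)
        + η * (2 / (T * (T + 3))) * (1 / 2 * ‖x - X ((k : ℤ) - 1)‖ ^ 2)
        + 4 * M ^ 2 / (η * (T + 3)) := by
    intro k hk hprev
    have h := hrun.primal_update k (by positivity) (by exact_mod_cast hk)
    have h1 := IsGradientSliding.exists_bound hU hconv hlow hup hw hT
      (η := fun s => η * ρ s) (by rw [hsumη]; exact hη) hprev h
    simpa only [hsumη, convexParams] using h1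
  -- The sliding bound needs a feasible starting point, which is the previous iterate, so
  -- feasibility is propagated first.
  have hXmem : ∀ k : ℕ, k ≤ N + 1 → X ((k : ℤ) - 1) ∈ U := by
    intro k
    induction k with
    | zero => intro _; rw [(hrun.init_primal _ (by simp)).1]; exact hx₀
    | succ k ih =>
      intro hk
      have := (hprimal k (by omega) (ih (by omega))).1
      simpa using this
  refine ⟨fun k hk => (hprimal k hk (hXmem k (by omega))).2.1, fun x hx hKx z hz => ?_⟩
  -- Since `∑ ρ s = 1`, the distance to `X k` is split among the blocks, each share paired with its
  -- own lagged center.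
  have hmain : ∀ k ∈ Finset.range (N + 1),
      F (Xhat k) - F x + ∑ s, ⟪K s (Xhat k), z s⟫_ℝ
      ≤ ∑ s, (η * ρ s * (1 / 2 * ‖x - X (k - r s)‖ ^ 2 - 1 / 2 * ‖x - X k‖ ^ 2)
          + (⟪K s (Xhat k), z s - y s ((k : ℤ) / r s)⟫_ℝ
            - η * ρ s * (1 / 2 * ‖Xhat k - X (k - r s)‖ ^ 2)))
        + η * (2 / (T * (T + 3)))
          * (1 / 2 * ‖x - X ((k : ℤ) - 1)‖ ^ 2 - 1 / 2 * ‖x - X k‖ ^ 2)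
        + 4 * M ^ 2 / (η * (T + 3)) := by
    intro k hk
    have hkN := Finset.mem_range.1 hk
    have h := (hprimal k (by omega) (hXmem k (by omega))).2.2 x hx
    simp only [sum_inner, ContinuousLinearMap.adjoint_inner_left, hKx, inner_zero_right,
      Finset.sum_const_zero, add_zero] at h
    have h2 : ∑ s, η * ρ s * (1 / 2 * ‖x - X k‖ ^ 2) = η * (1 / 2 * ‖x - X k‖ ^ 2) := by
      rw [← Finset.sum_mul, hsumη]
    have h3 : ∑ s, ⟪y s ((k : ℤ) / r s), K s (Xhat k)⟫_ℝ
        = ∑ s, ⟪K s (Xhat k), y s ((k : ℤ) / r s)⟫_ℝ :=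
      Finset.sum_congr rfl fun s _ => real_inner_comm _ _
    simp only [mul_sub, Finset.sum_add_distrib, Finset.sum_sub_distrib, inner_sub_right, h2]
    linarith
  have hsum := Finset.sum_le_sum hmain
  refine hsum.trans ?_
  rw [Finset.sum_add_distrib, Finset.sum_add_distrib, Finset.sum_comm]
  have hφneg : ∀ k < 0, 1 / 2 * ‖x - X k‖ ^ 2 = 1 / 2 * ‖x - x₀‖ ^ 2 := fun k hk => by
    rw [(hrun.init_primal k hk).1]
  have hblock : ∀ s, ∑ k ∈ Finset.range (N + 1),
      (η * ρ s * (1 / 2 * ‖x - X (k - r s)‖ ^ 2 - 1 / 2 * ‖x - X k‖ ^ 2)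
          + (⟪K s (Xhat k), z s - y s ((k : ℤ) / r s)⟫_ℝ
            - η * ρ s * (1 / 2 * ‖Xhat k - X (k - r s)‖ ^ 2)))
      ≤ η * (r s * ρ s) * (1 / 2 * ‖x - x₀‖ ^ 2)
        + r s * (2 * ‖K s‖ ^ 2 / (η * ρ s)) * (1 / 2 * ‖z s‖ ^ 2) := by
    intro s
    have hes : 0 < η * ρ s := mul_pos hη (hρ s)
    have h1 := sum_range_shift_sub_le (φ := fun k => 1 / 2 * ‖x - X k‖ ^ 2)
      (fun k => by positivity) hφneg (r s) (N + 1)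
    have h2 := mul_le_mul_of_nonneg_left h1 hes.le
    obtain ⟨l, hl⟩ := hN s
    -- Divisibility makes the horizon a whole number `l` of windows, so every window up to time `N`
    -- has its dual update.
    have h3 := sum_block_inner_le (K s) hrun.init_primal (hrun.init_dual s (-1) (by norm_num))
      (hr s) hes (z s) l (fun i hi => hrun.dual_step hc hr s i (by
        have : r s * i + r s ≤ r s * l := by
          rw [← Nat.mul_succ]; exact Nat.mul_le_mul_left _ hi
        have := hr s
        omega) (hz s))
    rw [← hl] at h3
    rw [Finset.sum_add_distrib, Finset.sum_sub_distrib, ← Finset.mul_sum]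
    linarith
  -- The restart terms have lag `1`, because sliding starts from `X (k - 1)`.
  have hprox := sum_range_shift_sub_le (φ := fun k => 1 / 2 * ‖x - X k‖ ^ 2)
      (fun k => by positivity) hφneg 1 (N + 1)
  have hprox' := mul_le_mul_of_nonneg_left hprox
    (by positivity : 0 ≤ η * (2 / ((T : ℝ) * (T + 3))))
  have hblocks := Finset.sum_le_sum fun s (_ : s ∈ Finset.univ) => hblock s
  have hrb : ∑ s, η * (r s * ρ s) * (1 / 2 * ‖x - x₀‖ ^ 2)
      = η * rbar r ρ * (1 / 2 * ‖x - x₀‖ ^ 2) := by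
    rw [← Finset.sum_mul, ← Finset.mul_sum, rbar]
  rw [Finset.sum_add_distrib, hrb] at hblocks
  rw [← Finset.mul_sum]
  simp only [Nat.cast_one, one_mul] at hprox'
  simp only [Finset.sum_const, Finset.card_range, nsmul_eq_mul, Nat.cast_add, Nat.cast_one]
  linarith

end Gap

/-! ### Row-space projections and the smallest nonzero singular value. -/

section Spectral

variable {E H : Type*} [NormedAddCommGroup E] [InnerProductSpace ℝ E] [FiniteDimensional ℝ E]
  [NormedAddCommGroup H] [InnerProductSpace ℝ H]

theorem rowProj_mem (A : E →L[ℝ] H) (X : E) :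
    rowProj A X ∈ (LinearMap.ker (A : E →ₗ[ℝ] H))ᗮ :=
  Submodule.starProjection_apply_mem _ X

theorem map_rowProj (A : E →L[ℝ] H) (X : E) : A (rowProj A X) = A X := by
  have h1 : X - rowProj A X ∈ (LinearMap.ker (A : E →ₗ[ℝ] H))ᗮᗮ :=
    Submodule.sub_starProjection_mem_orthogonal X
  rw [Submodule.orthogonal_orthogonal] at h1
  have h2 : A (X - rowProj A X) = 0 := h1
  rw [map_sub, sub_eq_zero] at h2
  exact h2.symm

theorem inner_rowProj_right (A : E →L[ℝ] H) (g X : E) :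
    ⟪g, rowProj A X⟫_ℝ = ⟪rowProj A g, rowProj A X⟫_ℝ := by
  have h1 : rowProj A (rowProj A X) = rowProj A X :=
    Submodule.starProjection_eq_self_iff.2 (rowProj_mem A X)
  conv_lhs => rw [← h1]
  exact (Submodule.inner_starProjection_left_eq_right _ g (rowProj A X)).symm

theorem sigmaMinPos_mul_norm_rowProj_le (A : E →L[ℝ] H) (X : E) :
    sigmaMinPos A * ‖rowProj A X‖ ≤ ‖A X‖ := by
  by_cases hX : rowProj A X = 0
  · simp [hX]
  · rw [← le_div_iff₀ (norm_pos_iff.2 hX)]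
    refine csInf_le ⟨0, ?_⟩ ⟨X, hX, rfl⟩
    rintro _ ⟨Y, _, rfl⟩
    positivity

/-- `A` is injective on the orthogonal complement of its kernel, hence bounded below there in finite
dimension. -/
theorem sigmaMinPos_pos {A : E →L[ℝ] H} (hA : A ≠ 0) : 0 < sigmaMinPos A := by
  set W := (LinearMap.ker (A : E →ₗ[ℝ] H))ᗮ with hW
  have hker : LinearMap.ker ((A : E →ₗ[ℝ] H) ∘ₗ W.subtype) = ⊥ := by
    rw [LinearMap.ker_eq_bot']
    intro x hx
    have h1 : (x : E) ∈ LinearMap.ker (A : E →ₗ[ℝ] H) := hx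
    have h2 : ⟪(x : E), x⟫_ℝ = 0 := (Submodule.mem_orthogonal _ _).1 x.2 _ h1
    exact Subtype.ext (inner_self_eq_zero.1 h2)
  obtain ⟨C, hC, hanti⟩ := LinearMap.exists_antilipschitzWith _ hker
  have hbound : ∀ X, ‖rowProj A X‖ ≤ C * ‖A X‖ := by
    intro X
    have h := hanti.le_mul_dist ⟨rowProj A X, rowProj_mem A X⟩ 0
    simpa [map_rowProj] using h
  have hC' : (0 : ℝ) < C := by exact_mod_cast hC
  refine lt_of_lt_of_le (inv_pos.2 hC') (le_csInf ?_ ?_)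
  · obtain ⟨X, hX⟩ := DFunLike.ne_iff.1 hA
    refine ⟨_, X, fun h0 => hX ?_, rfl⟩
    rw [← map_rowProj, h0, map_zero]
    rfl
  · rintro _ ⟨Y, hY, rfl⟩
    rw [le_div_iff₀ (norm_pos_iff.2 hY), inv_mul_le_iff₀ hC']
    exact hbound Y

end Spectral

/-! ### Consensus projection, block decomposition and similarity. -/

section Consensus

variable {m d S : ℕ} {n : Fin S → ℕ}

theorem bregman_liftHalfSq (X Z : Lifted m d) :
    bregman liftHalfSq X Z = 1 / 2 * ‖X - Z‖ ^ 2 := by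
  have h : (liftHalfSq : Lifted m d → ℝ) = halfSq := by
    funext Y
    rw [liftHalfSq, halfSq, PiLp.norm_sq_eq_of_L2, Finset.mul_sum]
    rfl
  rw [h, bregman_halfSq]

theorem convex_liftSet {Xbar : Set (Point d)} (h : Convex ℝ Xbar) : Convex ℝ (liftSet m Xbar) := by
  intro X hX Y hY a b ha hb hab v
  exact h (hX v) (hY v) ha hb hab

theorem convexOn_liftFun {Xbar : Set (Point d)} (h : Convex ℝ Xbar) {f : Fin m → Point d → ℝ}
    (hf : ∀ v, ConvexOn ℝ Xbar (f v)) : ConvexOn ℝ (liftSet m Xbar) (liftFun f) := by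
  refine ⟨convex_liftSet h, fun X hX Y hY a b ha hb hab => ?_⟩
  simp only [liftFun, smul_eq_mul, Finset.mul_sum, ← Finset.sum_add_distrib]
  exact Finset.sum_le_sum fun v _ => (hf v).2 (hX v) (hY v) ha hb hab

theorem inner_avg_sub_avg (X Y : Lifted m d) : ⟪avg Y, X - avg X⟫_ℝ = 0 := by
  rcases Nat.eq_zero_or_pos m with rfl | hm
  · simp [PiLp.inner_apply]
  have hm' : (m : ℝ) ≠ 0 := by exact_mod_cast hm.ne'
  rw [PiLp.inner_apply]
  simp only [avg, diag, PiLp.sub_apply, ← inner_sum, Finset.sum_sub_distrib, Finset.sum_const,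
    Finset.card_univ, Fintype.card_fin, ← Nat.cast_smul_eq_nsmul ℝ, smul_smul]
  rw [mul_one_div_cancel hm', one_smul, sub_self, inner_zero_right]

theorem inner_sub_avg_right (g X : Lifted m d) :
    ⟪g, X - avg X⟫_ℝ = ⟪g - avg g, X - avg X⟫_ℝ := by
  rw [inner_sub_left, inner_avg_sub_avg, sub_zero]

theorem avg_eq_self (hm : 0 < m) {X : Lifted m d} (h : ∀ v v', X v = X v') : avg X = X := by
  have hm' : (m : ℝ) ≠ 0 := by exact_mod_cast hm.ne'
  refine PiLp.ext fun v => ?_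
  have h1 : ∑ v', X v' = (m : ℝ) • X v := by
    rw [Finset.sum_congr rfl fun v' _ => h v' v, Finset.sum_const, Finset.card_univ,
      Fintype.card_fin, Nat.cast_smul_eq_nsmul]
  simp only [avg, diag, h1, smul_smul]
  rw [one_div_mul_cancel hm', one_smul]

theorem avg_mem_liftSet {Xbar : Set (Point d)} (h : Convex ℝ Xbar) {X : Lifted m d}
    (hX : X ∈ liftSet m Xbar) : avg X ∈ liftSet m Xbar := by
  intro v
  have hm : (m : ℝ) ≠ 0 := by exact_mod_cast v.pos.ne'
  simp only [avg, diag, Finset.smul_sum]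
  exact h.sum_mem (fun _ _ => by positivity) (by simp [hm]) fun i _ => hX i

theorem rowProj_stack_eq (hm : 0 < m) {K : ∀ s, Lifted m d →L[ℝ] Point (n s)}
    (hker : ∀ X, stack K X = 0 ↔ ∀ v v', X v = X v') (X : Lifted m d) :
    rowProj (stack K) X = X - avg X := by
  refine Submodule.eq_starProjection_of_mem_orthogonal ?_ ?_
  · rw [Submodule.mem_orthogonal]
    intro u hu
    rw [← avg_eq_self hm ((hker u).1 hu), inner_avg_sub_avg]
  · apply Submodule.le_orthogonal_orthogonal
    rw [sub_sub_cancel]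
    exact (hker _).2 fun _ _ => rfl

theorem stack_eq_zero_iff {K : ∀ s, Lifted m d →L[ℝ] Point (n s)} (X : Lifted m d) :
    stack K X = 0 ↔ ∀ s, K s X = 0 := by
  constructor
  · intro h s
    exact congrArg (fun Z : PiLp 2 (fun s => Point (n s)) => Z s) h
  · intro h
    exact PiLp.ext h

theorem norm_stack_le (K : ∀ s, Lifted m d →L[ℝ] Point (n s)) (X : Lifted m d) :
    ‖stack K X‖ ≤ ∑ s, ‖K s X‖ := by
  refine abs_le_of_sq_le_sq' ?_ (Finset.sum_nonneg fun _ _ => norm_nonneg _) |>.2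
  rw [PiLp.norm_sq_eq_of_L2]
  exact Finset.sum_sq_le_sq_sum_of_nonneg fun s _ => norm_nonneg (K s X)

/-- The orthogonality relations make each `K s` vanish on the row spaces of the other blocks, so the
sum of the projections has the same image under `stack K` as `X`. -/
theorem rowProj_stack_eq_sum {K : ∀ s, Lifted m d →L[ℝ] Point (n s)}
    (horth : ∀ s s', s ≠ s' → (K s) ∘L (K s').adjoint = 0) (X : Lifted m d) :
    rowProj (stack K) X = ∑ s, rowProj (K s) X := by
  have hzero : ∀ s s', s ≠ s' → K s (rowProj (K s') X) = 0 := by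
    intro s s' hss
    have h1 : LinearMap.range ((K s).adjoint : Point (n s) →ₗ[ℝ] Lifted m d)
        ≤ LinearMap.ker (K s' : Lifted m d →ₗ[ℝ] Point (n s')) := by
      rintro _ ⟨z, rfl⟩
      exact DFunLike.congr_fun (horth s' s hss.symm) z
    have h2 := Submodule.orthogonal_le h1 (rowProj_mem (K s') X)
    have h3 : ⟪(K s).adjoint (K s (rowProj (K s') X)), rowProj (K s') X⟫_ℝ = 0 :=
      (Submodule.mem_orthogonal _ _).1 h2 _ ⟨_, rfl⟩
    rw [ContinuousLinearMap.adjoint_inner_left] at h3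
    exact inner_self_eq_zero.1 h3
  refine (Submodule.eq_starProjection_of_mem_orthogonal ?_ ?_)
  · refine Submodule.sum_mem _ fun s _ => ?_
    refine Submodule.orthogonal_le ?_ (rowProj_mem (K s) X)
    intro u hu
    exact (stack_eq_zero_iff u).1 hu s
  · apply Submodule.le_orthogonal_orthogonal
    refine (stack_eq_zero_iff _).2 fun s => ?_
    rw [map_sub, map_sum, Finset.sum_eq_single s (fun s' _ h => hzero s s' h.symm) (by simp),
      map_rowProj, sub_self]

theorem IsLiftedOracle.le {Xbar : Set (Point d)} {f : Fin m → Point d → ℝ}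
    {g : Lifted m d → Lifted m d} (hg : IsLiftedOracle Xbar f g) {X Y : Lifted m d}
    (hX : X ∈ liftSet m Xbar) (hY : Y ∈ liftSet m Xbar) :
    liftFun f X + ⟪g X, Y - X⟫_ℝ ≤ liftFun f Y := by
  rw [PiLp.inner_apply, liftFun, liftFun, ← Finset.sum_add_distrib]
  exact Finset.sum_le_sum fun v _ => hg X hX v (Y v) (hY v)

theorem liftFun_diag_le_liftFun_avg {Xbar : Set (Point d)} (h : Convex ℝ Xbar)
    {f : Fin m → Point d → ℝ} {xs : Point d} (hmin : IsMinOn (fun x => ∑ v, f v x) Xbar xs)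
    {X : Lifted m d} (hX : X ∈ liftSet m Xbar) :
    liftFun f (diag m xs) ≤ liftFun f (avg X) := by
  rcases Nat.eq_zero_or_pos m with rfl | hm
  · simp [liftFun]
  · exact hmin (avg_mem_liftSet h hX ⟨0, hm⟩)

/-- The subgradient is taken at `avg X`, where similarity applies, and `X - avg X` sees only its
non-consensus part. -/
theorem Similar.le {Xbar : Set (Point d)} (h : Convex ℝ Xbar) {f : Fin m → Point d → ℝ} {a : ℝ}
    (hs : Similar Xbar f a) {X : Lifted m d} (hX : X ∈ liftSet m Xbar) :
    liftFun f (avg X) ≤ liftFun f X + a * ‖X - avg X‖ := by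
  obtain ⟨g, hg, hga⟩ := hs
  have h1 := hg.le (avg_mem_liftSet h hX) hX
  have h2 := hga (avg X) (avg_mem_liftSet h hX) fun _ _ => rfl
  rw [inner_sub_avg_right] at h1
  have h3 := neg_le_of_abs_le (abs_real_inner_le_norm (g (avg X) - avg (g (avg X))) (X - avg X))
  have h4 := mul_le_mul_of_nonneg_right h2 (norm_nonneg (X - avg X))
  linarith

theorem BlockSimilar.le (hm : 0 < m) {Xbar : Set (Point d)} (h : Convex ℝ Xbar)
    {f : Fin m → Point d → ℝ} {K : ∀ s, Lifted m d →L[ℝ] Point (n s)} {a : Fin S → ℝ}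
    (hs : BlockSimilar Xbar f K a) (hker : ∀ X, stack K X = 0 ↔ ∀ v v', X v = X v')
    {X : Lifted m d} (hX : X ∈ liftSet m Xbar) :
    liftFun f (avg X) ≤ liftFun f X + ∑ s, a s * ‖rowProj (K s) X‖ := by
  obtain ⟨horth, g, hg, hga⟩ := hs
  have h1 := hg.le (avg_mem_liftSet h hX) hX
  rw [← rowProj_stack_eq hm hker, rowProj_stack_eq_sum horth, inner_sum] at h1
  have h2 : ∑ s, -(a s * ‖rowProj (K s) X‖) ≤ ∑ s, ⟪g (avg X), rowProj (K s) X⟫_ℝ := by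
    refine Finset.sum_le_sum fun s _ => ?_
    rw [inner_rowProj_right]
    have h3 := neg_le_of_abs_le
      (abs_real_inner_le_norm (rowProj (K s) (g (avg X))) (rowProj (K s) X))
    have h4 := mul_le_mul_of_nonneg_right
      (hga s (avg X) (avg_mem_liftSet h hX) ((hker _).2 fun _ _ => rfl))
      (norm_nonneg (rowProj (K s) X))
    linarith
  rw [Finset.sum_neg_distrib] at h2
  linarith

end Consensus

/-! ### Tuned gap bound and exact penalties. -/

section Main

variable {m d S : ℕ} {n : Fin S → ℕ}

theorem one_le_rbar {r : Fin S → ℕ} {ρ : Fin S → ℝ} (hr : ∀ s, 0 < r s) (hρ : ∀ s, 0 < ρ s)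
    (hρ1 : ∑ s, ρ s = 1) : 1 ≤ rbar r ρ := by
  rw [← hρ1, rbar]
  refine Finset.sum_le_sum fun s _ => le_mul_of_one_le_left (hρ s).le ?_
  exact_mod_cast hr s

theorem exists_inner_eq_mul_norm {E : Type*} [NormedAddCommGroup E] [InnerProductSpace ℝ E] {c : ℝ}
    (hc : 0 ≤ c) (x : E) : ∃ z : E, ‖z‖ ≤ c ∧ ⟪x, z⟫_ℝ = c * ‖x‖ := by
  by_cases hx : x = 0
  · exact ⟨0, by simpa using hc, by simp [hx]⟩
  · have h0 : ‖x‖ ≠ 0 := norm_ne_zero_iff.2 hx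
    refine ⟨(c / ‖x‖) • x, ?_, ?_⟩
    · rw [norm_smul, Real.norm_of_nonneg (by positivity), div_mul_cancel₀ _ h0]
    · rw [inner_smul_right, real_inner_self_eq_norm_sq]
      field_simp

theorem dualSize_eq {K : ∀ s, Lifted m d →L[ℝ] Point (n s)} {c Dy : Fin S → ℝ}
    (hc : ∀ s, 0 ≤ c s) (hDy : ∀ s, Dy s = c s ^ 2 / 2) :
    dualSize K Dy * √2 = ∑ s, ‖K s‖ * c s := by
  rw [dualSize, Finset.sum_mul]
  refine Finset.sum_congr rfl fun s _ => ?_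
  have h2 : √2 ≠ 0 := by positivity
  rw [norm_adjoint_eq, hDy, Real.sqrt_div (sq_nonneg _), Real.sqrt_sq (hc s)]
  field_simp

theorem etaBase_mul {K : ∀ s, Lifted m d →L[ℝ] Point (n s)} {c Dy : Fin S → ℝ} {DX : ℝ}
    (hDX : 0 < DX) (hc : ∀ s, 0 ≤ c s) (hDy : ∀ s, Dy s = c s ^ 2 / 2) :
    etaBase K Dy DX * (√3 * √DX) = 2 * ∑ s, ‖K s‖ * c s := by
  have h3 : 0 < √3 * √DX := by positivity
  have h1 : √(8 / (3 * DX)) = √2 * 2 / (√3 * √DX) := by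
    rw [Real.sqrt_div (by norm_num), Real.sqrt_mul (by norm_num)]
    congr 1
    rw [show (8 : ℝ) = 2 * 2 ^ 2 by norm_num, Real.sqrt_mul (by norm_num),
      Real.sqrt_sq (by norm_num)]
  rw [etaBase, h1, ← dualSize_eq hc hDy]
  field_simp

/-- The primal-dual gap of the ergodic average, for balanced block weights. -/
theorem Runs.gap_le {Xbar : Set (Point d)} (hXcvx : Convex ℝ Xbar) {f : Fin m → Point d → ℝ}
    (hf : ∀ v, ConvexOn ℝ Xbar (f v)) {f' : Fin m → Point d → Point d} {M : ℝ}
    (hlow : ∀ X ∈ liftSet m Xbar, ∀ X' ∈ liftSet m Xbar,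
      0 ≤ liftFun f X - liftFun f X' - ⟪liftOracle f' X', X - X'⟫_ℝ)
    (hup : ∀ X ∈ liftSet m Xbar, ∀ X' ∈ liftSet m Xbar,
      liftFun f X - liftFun f X' - ⟪liftOracle f' X', X - X'⟫_ℝ ≤ M * ‖X - X'‖)
    {xs : Point d} (hxs : xs ∈ Xbar) (hS : 0 < S) {K : ∀ s, Lifted m d →L[ℝ] Point (n s)}
    (hK : ∀ s, K s ≠ 0) (hker : ∀ X, stack K X = 0 ↔ ∀ v v', X v = X v')
    {r : Fin S → ℕ} (hr : ∀ s, 0 < r s) {N : ℕ} (hN : ∀ s, r s ∣ N + 1) {Xinit : Lifted m d}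
    (hXinit : Xinit ∈ liftSet m Xbar) {DX : ℝ} (hDX0 : 0 < DX)
    (hDX : bregman liftHalfSq (diag m xs) Xinit ≤ DX) {ε : ℝ} (hε : 0 < ε) {c Dy ρ : Fin S → ℝ}
    (hc : ∀ s, 0 < c s) (hDy : ∀ s, Dy s = c s ^ 2 / 2)
    (hρ : ∀ s, ρ s = ‖K s‖ * c s / ∑ s', ‖K s'‖ * c s')
    (hNε : 2 * √3 * rbar r ρ * (∑ s, ‖K s‖ * c s) * √DX / ε ≤ N) {Xhat : ℤ → Lifted m d}
    (hrun : Runs Xbar f' K M r Xinit DX N c Dy ρ Xhat) :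
    ergodic N Xhat ∈ liftSet m Xbar ∧
      liftFun f (ergodic N Xhat) + ∑ s, c s * ‖K s (ergodic N Xhat)‖
        ≤ liftFun f (diag m xs) + ε := by
  obtain ⟨T, X, y, hT, hTM, hrun⟩ := hrun
  have : Nonempty (Fin S) := ⟨⟨0, hS⟩⟩
  have hKc : ∀ s, 0 < ‖K s‖ * c s := fun s => mul_pos (norm_pos_iff.2 (hK s)) (hc s)
  set A := ∑ s, ‖K s‖ * c s with hA
  have hA0 : 0 < A := Finset.sum_pos (fun s _ => hKc s) Finset.univ_nonempty
  have hρ0 : ∀ s, 0 < ρ s := fun s => by rw [hρ]; exact div_pos (hKc s) hA0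
  have hρ1 : ∑ s, ρ s = 1 := by
    simp only [hρ]
    rw [← Finset.sum_div, ← hA, div_self hA0.ne']
  have hrb := one_le_rbar hr hρ0 hρ1
  have hηeq := etaBase_mul (K := K) hDX0 (fun s => (hc s).le) hDy
  rw [← hA] at hηeq
  set η := etaBase K Dy DX with hη
  set R := rbar r ρ
  -- In this scale `η = 2A / w`, and the primal, sliding and dual errors are at most `R * A * w`
  -- times `1`, `1/4` and `1/2`; their sum is below `2 * (R * A * w) ≤ ε * N`.
  set w := √3 * √DX with hwdef
  have hw0 : 0 < w := by positivity
  have hw2 : w ^ 2 = 3 * DX := by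
    rw [hwdef, mul_pow, Real.sq_sqrt (by norm_num), Real.sq_sqrt hDX0.le]
  have hη0 : 0 < η := pos_of_mul_pos_left (by rw [hηeq]; positivity) hw0.le
  have hηval : η = 2 * A / w := by rw [eq_div_iff hw0.ne', hηeq]
  have hconvF := convexOn_liftFun hXcvx hf
  have hU := convex_liftSet (m := m) hXcvx
  obtain ⟨hmem, hgap⟩ := hrun.sum_gap_le hU hconvF hlow hup bregman_liftHalfSq hXinit hρ0 hρ1 hη0
    (fun s => (hc s).le) hr hN hT
  have hN0 : (0 : ℝ) < (N : ℝ) + 1 := by positivity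
  have hwt : ∑ _k ∈ Finset.range (N + 1), ((N : ℝ) + 1)⁻¹ = 1 := by
    rw [Finset.sum_const, Finset.card_range, nsmul_eq_mul]
    push_cast
    exact mul_inv_cancel₀ hN0.ne'
  have herg : ergodic N Xhat = ∑ k ∈ Finset.range (N + 1), ((N : ℝ) + 1)⁻¹ • Xhat (k : ℤ) := by
    rw [ergodic, Finset.smul_sum]
  have hmem' : ∀ k ∈ Finset.range (N + 1), Xhat (k : ℤ) ∈ liftSet m Xbar := fun k hk =>
    hmem k (by have := Finset.mem_range.1 hk; omega)
  refine ⟨?_, ?_⟩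
  · rw [herg]
    exact hU.sum_mem (fun _ _ => by positivity) hwt hmem'
  have hjensen : liftFun f (ergodic N Xhat)
      ≤ ∑ k ∈ Finset.range (N + 1), ((N : ℝ) + 1)⁻¹ • liftFun f (Xhat (k : ℤ)) := by
    rw [herg]
    exact hconvF.map_sum_le (fun _ _ => by positivity) hwt hmem'
  -- The gap bound holds for every dual point of the balls, so `z` may depend on the ergodic
  -- average; alignment turns the products into the penalty.
  choose z hz hzeq using fun s => exists_inner_eq_mul_norm (hc s).le (K s (ergodic N Xhat))
  have h1 := hgap (diag m xs) (fun _ => hxs)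
    ((stack_eq_zero_iff _).1 ((hker _).2 fun _ _ => rfl)) z hz
  -- the three error terms
  have hprimal : η * (R + 2 / (T * (T + 3))) * (1 / 2 * ‖diag m xs - Xinit‖ ^ 2)
      ≤ R * A * w := by
    rw [bregman_liftHalfSq] at hDX
    have hT1 : (1 : ℝ) ≤ T := by exact_mod_cast hT
    -- With `1 ≤ R`, the restart term costs at most half of `R`, whence the factor `3 / 2`.
    have h2 : 2 / ((T : ℝ) * (T + 3)) ≤ 1 / 2 := by
      rw [div_le_div_iff₀ (by positivity) (by norm_num)]
      nlinarith
    calc η * (R + 2 / (T * (T + 3))) * (1 / 2 * ‖diag m xs - Xinit‖ ^ 2)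
        ≤ η * (3 / 2 * R) * DX := by gcongr; linarith
      _ = R * A * w := by
        rw [hηval, show DX = w ^ 2 / 3 by linarith]
        field_simp
  have hslide : ((N : ℝ) + 1) * (4 * M ^ 2 / (η * (T + 3))) ≤ R * A * w / 4 := by
    have hB : dualSize K Dy ^ 2 = A ^ 2 / 2 := by
      have h2 := dualSize_eq (K := K) (fun s => (hc s).le) hDy
      rw [hA, ← h2, mul_pow, Real.sq_sqrt (by norm_num)]
      ring
    -- A floor at most `T` bounds the real number by `T + 1`, and the sliding error has `T + 3` in
    -- its denominator.
    have h2 := (Nat.floor_lt (by positivity)).1 (Nat.lt_succ_of_le hTM)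
    rw [hB, div_lt_iff₀ (by positivity)] at h2
    push_cast at h2
    have h3 : 4 * M ^ 2 * ((N : ℝ) + 1) ≤ (T + 3) * (R * (A ^ 2 / 2)) :=
      h2.le.trans (by gcongr; norm_num)
    rw [mul_div_assoc', div_le_iff₀ (by positivity)]
    have h4 : R * A * w / 4 * (η * (T + 3)) = (T + 3) * (R * (A ^ 2 / 2)) := by
      rw [hηval]; field_simp; ring
    linarith
  have hdual : ∑ s, r s * (2 * ‖K s‖ ^ 2 / (η * ρ s)) * (1 / 2 * ‖z s‖ ^ 2) ≤ R * A * w / 2 := by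
    have h2 : R * A * w / 2 = ∑ s, A * w / 2 * (r s * ρ s) := by
      rw [← Finset.mul_sum]; change R * A * w / 2 = A * w / 2 * R; ring
    rw [h2]
    refine Finset.sum_le_sum fun s _ => ?_
    have hes : 0 < η * ρ s := mul_pos hη0 (hρ0 s)
    calc r s * (2 * ‖K s‖ ^ 2 / (η * ρ s)) * (1 / 2 * ‖z s‖ ^ 2)
        ≤ r s * (2 * ‖K s‖ ^ 2 / (η * ρ s)) * (1 / 2 * c s ^ 2) := by
          gcongr; exact hz s
      _ = r s * (‖K s‖ * c s) ^ 2 / (η * ρ s) := by ring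
      _ = A * w / 2 * (r s * ρ s) := by
        -- The balanced weights cancel one `ρ s`, so the dual errors add up to a multiple of `rbar`.
        have h3 : ‖K s‖ * c s = ρ s * A := by rw [hρ, div_mul_cancel₀ _ hA0.ne']
        have := (hρ0 s).ne'
        rw [h3, hηval]
        field_simp
  have hRAw : 2 * (R * A * w) ≤ ε * N := by
    rw [div_le_iff₀ hε] at hNε
    rw [hwdef]
    linarith
  have hRAw0 : 0 ≤ R * A * w := by positivity
  have htotal : ∑ k ∈ Finset.range (N + 1),
      (liftFun f (Xhat k) - liftFun f (diag m xs) + ∑ s, ⟪K s (Xhat k), z s⟫_ℝ)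
      ≤ ((N : ℝ) + 1) * ε := by
    linarith
  have hlin : ∑ s, c s * ‖K s (ergodic N Xhat)‖
      = ∑ k ∈ Finset.range (N + 1), ((N : ℝ) + 1)⁻¹ * ∑ s, ⟪K s (Xhat (k : ℤ)), z s⟫_ℝ := by
    rw [← Finset.sum_congr rfl fun s _ => hzeq s]
    simp only [herg, map_sum, map_smul, sum_inner, real_inner_smul_left]
    rw [Finset.sum_comm]
    simp only [Finset.mul_sum]
  have hdiv : ((N : ℝ) + 1)⁻¹ * ∑ k ∈ Finset.range (N + 1),
      (liftFun f (Xhat k) - liftFun f (diag m xs) + ∑ s, ⟪K s (Xhat k), z s⟫_ℝ) ≤ ε := by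
    rw [inv_mul_le_iff₀ hN0]; exact htotal
  simp only [Finset.mul_sum (Finset.range (N + 1)), mul_add, mul_sub, Finset.sum_add_distrib,
    Finset.sum_sub_distrib, ← Finset.sum_mul, hwt, one_mul] at hdiv
  simp only [smul_eq_mul] at hjensen
  linarith

/-- Optimality of `xs` against `avg X` bounds `F` from below by `F(X*) - q`; the part of the penalty
exceeding `q` must then be at most `ε`. -/
theorem isSolution_of_gap {Xbar : Set (Point d)} (hXcvx : Convex ℝ Xbar)
    {f : Fin m → Point d → ℝ} {xs : Point d} (hmin : IsMinOn (fun x => ∑ v, f v x) Xbar xs)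
    {ξ ε p q : ℝ} (hξ : 0 < ξ) {X : Lifted m d} (hX : X ∈ liftSet m Xbar)
    (hgap : liftFun f X + p ≤ liftFun f (diag m xs) + ε)
    (havg : liftFun f (avg X) ≤ liftFun f X + q) (hp : 0 ≤ p) (hpq : q + ξ * ‖X - avg X‖ ≤ p) :
    IsSolution Xbar f xs ε (ε / ξ) X := by
  refine ⟨hX, by linarith, ?_⟩
  have h1 := liftFun_diag_le_liftFun_avg hXcvx hmin hX
  rw [le_div_iff₀ hξ]
  linarith

/-- The penalty pays for the whole cost of projecting, so `avg X` is already within `ε`; the factor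
`1 + 1 / ξ` is slack. -/
theorem isSolution_avg_of_gap {Xbar : Set (Point d)} (hXcvx : Convex ℝ Xbar) (hm : 0 < m)
    {f : Fin m → Point d → ℝ} {xs : Point d} {ξ ε p q : ℝ} (hξ : 0 < ξ) (hε : 0 < ε)
    {X : Lifted m d} (hX : X ∈ liftSet m Xbar)
    (hgap : liftFun f X + p ≤ liftFun f (diag m xs) + ε)
    (havg : liftFun f (avg X) ≤ liftFun f X + q) (hpq : q ≤ p) :
    IsSolution Xbar f xs (ε * (1 + 1 / ξ)) 0 (avg X) := by
  refine ⟨avg_mem_liftSet hXcvx hX, ?_, ?_⟩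
  · have : 0 ≤ ε * (1 / ξ) := by positivity
    linarith
  · rw [avg_eq_self hm (X := avg X) fun _ _ => rfl, sub_self, norm_zero]

theorem mul_norm_sub_avg_le_sum (hm : 0 < m) {K : ∀ s, Lifted m d →L[ℝ] Point (n s)}
    (hker : ∀ X, stack K X = 0 ↔ ∀ v v', X v = X v') (hσ : 0 < sigmaMinPos (stack K)) {b : ℝ}
    (hb : 0 ≤ b) {c : Fin S → ℝ} (hc : ∀ s, c s = b / sigmaMinPos (stack K)) (X : Lifted m d) :
    b * ‖X - avg X‖ ≤ ∑ s, c s * ‖K s X‖ := by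
  have h1 := sigmaMinPos_mul_norm_rowProj_le (stack K) X
  rw [rowProj_stack_eq hm hker] at h1
  simp only [hc, ← Finset.mul_sum]
  calc b * ‖X - avg X‖
      = b / sigmaMinPos (stack K) * (sigmaMinPos (stack K) * ‖X - avg X‖) := by field_simp
    _ ≤ b / sigmaMinPos (stack K) * ∑ s, ‖K s X‖ := by
      gcongr
      exact h1.trans (norm_stack_le K X)

theorem sum_mul_norm_rowProj_le_sum {K : ∀ s, Lifted m d →L[ℝ] Point (n s)} (hK : ∀ s, K s ≠ 0)
    {b c : Fin S → ℝ} (hb : ∀ s, 0 ≤ b s) (hc : ∀ s, c s = b s / sigmaMinPos (K s))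
    (X : Lifted m d) :
    ∑ s, b s * ‖rowProj (K s) X‖ ≤ ∑ s, c s * ‖K s X‖ := by
  refine Finset.sum_le_sum fun s _ => ?_
  have hσ := sigmaMinPos_pos (hK s)
  have h1 := sigmaMinPos_mul_norm_rowProj_le (K s) X
  rw [hc]
  calc b s * ‖rowProj (K s) X‖
      = b s / sigmaMinPos (K s) * (sigmaMinPos (K s) * ‖rowProj (K s) X‖) := by field_simp
    _ ≤ b s / sigmaMinPos (K s) * ‖K s X‖ :=
      mul_le_mul_of_nonneg_left h1 (div_nonneg (hb s) hσ.le)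

theorem norm_sub_avg_le_sum (hm : 0 < m) {K : ∀ s, Lifted m d →L[ℝ] Point (n s)}
    (hker : ∀ X, stack K X = 0 ↔ ∀ v v', X v = X v')
    (horth : ∀ s s', s ≠ s' → (K s) ∘L (K s').adjoint = 0) (X : Lifted m d) :
    ‖X - avg X‖ ≤ ∑ s, ‖rowProj (K s) X‖ := by
  rw [← rowProj_stack_eq hm hker, rowProj_stack_eq_sum horth]
  exact norm_sum_le _ _

theorem Similar.nonneg {Xbar : Set (Point d)} {f : Fin m → Point d → ℝ} {a : ℝ}
    (h : Similar Xbar f a) {x : Point d} (hx : x ∈ Xbar) : 0 ≤ a := by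
  obtain ⟨g, _, hga⟩ := h
  exact (norm_nonneg _).trans (hga (diag m x) (fun _ => hx) fun _ _ => rfl)

theorem BlockSimilar.nonneg {Xbar : Set (Point d)} {f : Fin m → Point d → ℝ}
    {K : ∀ s, Lifted m d →L[ℝ] Point (n s)} {a : Fin S → ℝ} (h : BlockSimilar Xbar f K a)
    (hker : ∀ X, stack K X = 0 ↔ ∀ v v', X v = X v') {x : Point d} (hx : x ∈ Xbar) (s : Fin S) :
    0 ≤ a s := by
  obtain ⟨_, g, _, hga⟩ := h
  exact (norm_nonneg _).trans (hga s (diag m x) (fun _ => hx) ((hker _).2 fun _ _ => rfl))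

end Main

end MTPDHG

/-! ### The four parameter choices. -/

open MTPDHG in
theorem corollary7 {m d S : ℕ} {n : Fin S → ℕ}
    -- the distributed problem: minimize `∑ v, f v` over `Xbar`, with local subgradient oracles
    (Xbar : Set (MTPDHG.Point d)) (hXne : Xbar.Nonempty) (hXcl : IsClosed Xbar)
    (hXcvx : Convex ℝ Xbar)
    (f : Fin m → MTPDHG.Point d → ℝ) (hf : ∀ v, ConvexOn ℝ Xbar (f v))
    (f' : Fin m → MTPDHG.Point d → MTPDHG.Point d)
    (hf' : ∀ v, ∀ x ∈ Xbar, MTPDHG.IsSubgradient Xbar (f v) x (f' v x))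
    (M μ : ℝ) (hM : 0 ≤ M) (hμ : 0 ≤ μ)
    (hF : ∀ X ∈ MTPDHG.liftSet m Xbar, ∀ X' ∈ MTPDHG.liftSet m Xbar,
      μ / 2 * ‖X - X'‖ ^ 2 ≤ MTPDHG.liftFun f X - MTPDHG.liftFun f X'
          - inner ℝ (MTPDHG.liftOracle f' X') (X - X') ∧
      MTPDHG.liftFun f X - MTPDHG.liftFun f X'
          - inner ℝ (MTPDHG.liftOracle f' X') (X - X') ≤ M * ‖X - X'‖)
    (xs : MTPDHG.Point d) (hxs : xs ∈ Xbar) (hmin : IsMinOn (fun x => ∑ v, f v x) Xbar xs)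
    -- the consensus operators
    (hS : 0 < S) (K : ∀ s, MTPDHG.Lifted m d →L[ℝ] MTPDHG.Point (n s)) (hK : ∀ s, K s ≠ 0)
    (hker : ∀ X, MTPDHG.stack K X = 0 ↔ ∀ v v', X v = X v')
    -- update rates, horizon, initialization and accuracies
    (r : Fin S → ℕ) (hr : ∀ s, 0 < r s) (N : ℕ) (hN : ∀ s, r s ∣ N + 1)
    (Xinit : MTPDHG.Lifted m d) (hXinit : Xinit ∈ MTPDHG.liftSet m Xbar)
    (DX : ℝ) (hDX0 : 0 < DX)
    (hDX : MTPDHG.bregman MTPDHG.liftHalfSq (MTPDHG.diag m xs) Xinit ≤ DX)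
    (ξ ε : ℝ) (hξ : 0 < ξ) (hε : 0 < ε) :
    -- one similarity constant for all blocks
    (∀ a : ℝ, MTPDHG.Similar Xbar f a →
      ∀ ρ : Fin S → ℝ, (∀ s, ρ s = ‖K s‖ / ∑ s', ‖K s'‖) →
      -- penalties that control the consensus violation
      (∀ c Dy : Fin S → ℝ, ∀ A : ℝ,
        (∀ s, c s = (ξ + a) / MTPDHG.sigmaMinPos (MTPDHG.stack K)) →
        (∀ s, Dy s = c s ^ 2 / 2) →
        A = (∑ s, ‖K s‖) / MTPDHG.sigmaMinPos (MTPDHG.stack K) * (ξ + a) →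
        (∀ s, MTPDHG.IsDualRadius (k := n s) (c s) (Dy s)) ∧
        (2 * √3 * MTPDHG.rbar r ρ * A * √DX / ε ≤ N →
          ∀ Xhat, MTPDHG.Runs Xbar f' K M r Xinit DX N c Dy ρ Xhat →
            MTPDHG.IsSolution Xbar f xs ε (ε / ξ) (MTPDHG.ergodic N Xhat))) ∧
      -- penalties for the projected solution
      (0 < a → ∀ c Dy : Fin S → ℝ, ∀ A : ℝ,
        (∀ s, c s = (1 + ξ) * a / MTPDHG.sigmaMinPos (MTPDHG.stack K)) →
        (∀ s, Dy s = c s ^ 2 / 2) →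
        A = (1 + ξ) * (∑ s, ‖K s‖) * a / MTPDHG.sigmaMinPos (MTPDHG.stack K) →
        (∀ s, MTPDHG.IsDualRadius (k := n s) (c s) (Dy s)) ∧
        (2 * √3 * MTPDHG.rbar r ρ * A * √DX / ε ≤ N →
          ∀ Xhat, MTPDHG.Runs Xbar f' K M r Xinit DX N c Dy ρ Xhat →
            MTPDHG.IsSolution Xbar f xs (ε * (1 + 1 / ξ)) 0
              (MTPDHG.avg (MTPDHG.ergodic N Xhat))))) ∧
    -- one similarity constant per block
    (∀ a : Fin S → ℝ, MTPDHG.BlockSimilar Xbar f K a →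
      -- penalties that control the consensus violation
      (∀ c Dy ρ : Fin S → ℝ, ∀ A : ℝ,
        (∀ s, c s = (ξ + a s) / MTPDHG.sigmaMinPos (K s)) →
        (∀ s, Dy s = c s ^ 2 / 2) →
        (∀ s, ρ s = (‖K s‖ * ((ξ + a s) / MTPDHG.sigmaMinPos (K s)))
          / ∑ s', ‖K s'‖ * ((ξ + a s') / MTPDHG.sigmaMinPos (K s'))) →
        A = ∑ s, (ξ + a s) * (‖K s‖ / MTPDHG.sigmaMinPos (K s)) →
        (∀ s, MTPDHG.IsDualRadius (k := n s) (c s) (Dy s)) ∧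
        (2 * √3 * MTPDHG.rbar r ρ * A * √DX / ε ≤ N →
          ∀ Xhat, MTPDHG.Runs Xbar f' K M r Xinit DX N c Dy ρ Xhat →
            MTPDHG.IsSolution Xbar f xs ε (ε / ξ) (MTPDHG.ergodic N Xhat))) ∧
      -- penalties for the projected solution
      ((∀ s, 0 < a s) → ∀ c Dy ρ : Fin S → ℝ, ∀ A : ℝ,
        (∀ s, c s = (1 + ξ) * a s / MTPDHG.sigmaMinPos (K s)) →
        (∀ s, Dy s = c s ^ 2 / 2) →
        (∀ s, ρ s = (‖K s‖ * (a s / MTPDHG.sigmaMinPos (K s)))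
          / ∑ s', ‖K s'‖ * (a s' / MTPDHG.sigmaMinPos (K s'))) →
        A = (1 + ξ) * ∑ s, a s * (‖K s‖ / MTPDHG.sigmaMinPos (K s)) →
        (∀ s, MTPDHG.IsDualRadius (k := n s) (c s) (Dy s)) ∧
        (2 * √3 * MTPDHG.rbar r ρ * A * √DX / ε ≤ N →
          ∀ Xhat, MTPDHG.Runs Xbar f' K M r Xinit DX N c Dy ρ Xhat →
            MTPDHG.IsSolution Xbar f xs (ε * (1 + 1 / ξ)) 0
              (MTPDHG.avg (MTPDHG.ergodic N Xhat))))) := by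
  have : Nonempty (Fin S) := ⟨⟨0, hS⟩⟩
  obtain ⟨s₀⟩ := this
  -- Without agents the lifted space is trivial and every `K s` would be zero.
  have hm : 0 < m := by
    rcases Nat.eq_zero_or_pos m with rfl | h
    · exact absurd (ContinuousLinearMap.ext fun X => by rw [Subsingleton.elim X 0]; simp) (hK s₀)
    · exact h
  have hstack : stack K ≠ 0 := by
    intro h
    refine hK s₀ (ContinuousLinearMap.ext fun X => ?_)
    exact (stack_eq_zero_iff X).1 (by rw [h]; rfl) s₀
  have hσ := sigmaMinPos_pos hstack
  have hσs : ∀ s, 0 < sigmaMinPos (K s) := fun s => sigmaMinPos_pos (hK s)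
  have hKn : ∀ s, 0 < ‖K s‖ := fun s => norm_pos_iff.2 (hK s)
  have hlow : ∀ X ∈ liftSet m Xbar, ∀ X' ∈ liftSet m Xbar,
      0 ≤ liftFun f X - liftFun f X' - inner ℝ (liftOracle f' X') (X - X') :=
    fun X hX X' hX' => le_trans (by positivity) (hF X hX X' hX').1
  have hup : ∀ X ∈ liftSet m Xbar, ∀ X' ∈ liftSet m Xbar,
      liftFun f X - liftFun f X' - inner ℝ (liftOracle f' X') (X - X') ≤ M * ‖X - X'‖ :=
    fun X hX X' hX' => (hF X hX X' hX').2
  have hradius : ∀ c Dy : Fin S → ℝ, (∀ s, 0 < c s) → (∀ s, Dy s = c s ^ 2 / 2) →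
      ∀ s, IsDualRadius (k := n s) (c s) (Dy s) := by
    intro c Dy hc hDy s
    have : Nontrivial (Point (n s)) := by
      obtain ⟨X, hX⟩ := DFunLike.ne_iff.1 (hK s)
      exact ⟨K s X, 0, hX⟩
    rw [hDy]
    exact isDualRadius_scaledNorm (hc s).le
  refine ⟨fun a ha ρ hρ => ?_, fun a ha => ?_⟩
  · have ha0 := ha.nonneg hxs
    -- Equal penalties cancel, so weights proportional to `‖K s‖` are the balanced ones.
    have hbal : ∀ c : Fin S → ℝ, ∀ b : ℝ, 0 < b → (∀ s, c s = b) →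
        ∀ s, ρ s = ‖K s‖ * c s / ∑ s', ‖K s'‖ * c s' := by
      intro c b hb hc s
      simp only [hc, ← Finset.sum_mul]
      rw [hρ, mul_div_mul_right _ _ hb.ne']
    have hA : ∀ c : Fin S → ℝ, ∀ b : ℝ, (∀ s, c s = b) →
        ∑ s, ‖K s‖ * c s = (∑ s, ‖K s‖) * b := by
      intro c b hc
      simp only [hc, ← Finset.sum_mul]
    refine ⟨fun c Dy A hc hDy hAeq => ?_, fun hapos c Dy A hc hDy hAeq => ?_⟩
    · have hb : 0 < (ξ + a) / sigmaMinPos (stack K) := by positivity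
      have hc0 : ∀ s, 0 < c s := fun s => by rw [hc]; exact hb
      refine ⟨hradius c Dy hc0 hDy, fun hNε Xhat hrun => ?_⟩
      have hA' : A = ∑ s, ‖K s‖ * c s := by rw [hA c _ hc, hAeq]; ring
      rw [hA'] at hNε
      obtain ⟨hmem, hgap⟩ := hrun.gap_le hXcvx hf hlow hup hxs hS hK hker hr hN hXinit hDX0 hDX hε
        hc0 hDy (hbal c _ hb hc) hNε
      have hpen := mul_norm_sub_avg_le_sum hm hker hσ (by positivity) hc (ergodic N Xhat)
      exact isSolution_of_gap hXcvx hmin hξ hmem hgap (ha.le hXcvx hmem)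
        (Finset.sum_nonneg fun s _ => mul_nonneg (hc0 s).le (norm_nonneg _)) (by linarith)
    · have hb : 0 < (1 + ξ) * a / sigmaMinPos (stack K) := by positivity
      have hc0 : ∀ s, 0 < c s := fun s => by rw [hc]; exact hb
      refine ⟨hradius c Dy hc0 hDy, fun hNε Xhat hrun => ?_⟩
      have hA' : A = ∑ s, ‖K s‖ * c s := by rw [hA c _ hc, hAeq]; ring
      rw [hA'] at hNε
      obtain ⟨hmem, hgap⟩ := hrun.gap_le hXcvx hf hlow hup hxs hS hK hker hr hN hXinit hDX0 hDX hε
        hc0 hDy (hbal c _ hb hc) hNε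
      have hpen := mul_norm_sub_avg_le_sum hm hker hσ (by positivity) hc (ergodic N Xhat)
      have hextra : 0 ≤ ξ * a * ‖ergodic N Xhat - avg (ergodic N Xhat)‖ := by positivity
      exact isSolution_avg_of_gap hXcvx hm hξ hε hmem hgap (ha.le hXcvx hmem) (by linarith)
  · have ha0 := ha.nonneg hker hxs
    refine ⟨fun c Dy ρ A hc hDy hρ hAeq => ?_, fun hapos c Dy ρ A hc hDy hρ hAeq => ?_⟩
    · have hb : ∀ s, 0 < ξ + a s := fun s => add_pos_of_pos_of_nonneg hξ (ha0 s)
      have hc0 : ∀ s, 0 < c s := fun s => by rw [hc]; exact div_pos (hb s) (hσs s)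
      refine ⟨hradius c Dy hc0 hDy, fun hNε Xhat hrun => ?_⟩
      have hA' : A = ∑ s, ‖K s‖ * c s := by
        rw [hAeq]
        exact Finset.sum_congr rfl fun s _ => by rw [hc]; ring
      rw [hA'] at hNε
      obtain ⟨hmem, hgap⟩ := hrun.gap_le hXcvx hf hlow hup hxs hS hK hker hr hN hXinit hDX0 hDX hε
        hc0 hDy (fun s => by simp only [hρ, hc]) hNε
      have hpen := sum_mul_norm_rowProj_le_sum hK (fun s => (hb s).le) hc (ergodic N Xhat)
      have hnorm := mul_le_mul_of_nonneg_left
        (norm_sub_avg_le_sum hm hker ha.1 (ergodic N Xhat)) hξ.le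
      simp only [add_mul, Finset.sum_add_distrib, ← Finset.mul_sum] at hpen
      exact isSolution_of_gap hXcvx hmin hξ hmem hgap (ha.le hm hXcvx hker hmem)
        (Finset.sum_nonneg fun s _ => mul_nonneg (hc0 s).le (norm_nonneg _)) (by linarith)
    · have hb : ∀ s, 0 < (1 + ξ) * a s := fun s => mul_pos (by positivity) (hapos s)
      have hc0 : ∀ s, 0 < c s := fun s => by rw [hc]; exact div_pos (hb s) (hσs s)
      refine ⟨hradius c Dy hc0 hDy, fun hNε Xhat hrun => ?_⟩
      have hA' : A = ∑ s, ‖K s‖ * c s := by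
        rw [hAeq, Finset.mul_sum]
        exact Finset.sum_congr rfl fun s _ => by rw [hc]; ring
      rw [hA'] at hNε
      have hbal : ∀ s, ρ s = ‖K s‖ * c s / ∑ s', ‖K s'‖ * c s' := by
        intro s
        have h1 : ∀ s, ‖K s‖ * c s = (1 + ξ) * (‖K s‖ * (a s / sigmaMinPos (K s))) := fun s => by
          rw [hc]; ring
        have hξ1 : (1 + ξ) ≠ 0 := by positivity
        simp only [h1, ← Finset.mul_sum]
        rw [hρ, mul_div_mul_left _ _ hξ1]
      obtain ⟨hmem, hgap⟩ := hrun.gap_le hXcvx hf hlow hup hxs hS hK hker hr hN hXinit hDX0 hDX hε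
        hc0 hDy hbal hNε
      have hpen := sum_mul_norm_rowProj_le_sum hK (fun s => (hb s).le) hc (ergodic N Xhat)
      have hle : ∑ s, a s * ‖rowProj (K s) (ergodic N Xhat)‖
          ≤ ∑ s, (1 + ξ) * a s * ‖rowProj (K s) (ergodic N Xhat)‖ := by
        refine Finset.sum_le_sum fun s _ => ?_
        have : 0 ≤ ξ * a s * ‖rowProj (K s) (ergodic N Xhat)‖ :=
          mul_nonneg (mul_nonneg hξ.le (ha0 s)) (norm_nonneg _)
        linarith
      exact isSolution_avg_of_gap hXcvx hm hξ hε hmem hgap (ha.le hm hXcvx hker hmem)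
        (hle.trans hpen)
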